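/- Let $p\ge 1$ be real and let $\mu$ be a Borel probability measure on $[0,+\infty)$ (for instance on $(0,+\infty)$) whose support contains $0$. For a Dirichlet polynomial $P(s)=\sum_{n=1}^N a_n n^{-s}$ put $P_\sigma(s)=P(\sigma+s)$, and let $$\|P\|_{\mathcal H^p}=\Big(\int_{\mathbb T^\infty}\Big|\sum_{n=1}^N a_n\chi(n)\Big|^p\,dm(\chi)\Big)^{1/p},\qquad \|P\|_{\mathcal A^p_\mu}=\Big(\int_{[0,+\infty)}\|P_\sigma\|_{\mathcal H^p}^p\,d\mu(\sigma)\Big)^{1/p},$$ where $m$ is the normalized Haar measure of the infinite polytorus $\mathbb T^\infty$ (one coordinate $\chi(q)$ in the unit circle $\mathbb T$ for each prime $q$) and $\chi(n)$ is extended from the primes to all $n\ge1$ by complete multiplicativity. Let $\mathcal A^p_\mu$ be the completion of the space of Dirichlet polynomials for $\|\cdot\|_{\mathcal A^p_\mu}$. Then $\mathcal A^p_\mu$ is a space of Dirichlet series with abscissa of uniform convergence at most $1/2$. Precisely: for every $s$ with $\Re s>1/2$ the evaluation $P\mapsto P(s)$ extends to a (necessarily unique) bounded linear functional $\delta_s$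 on $\mathcal A^p_\mu$; for every $f\in\mathcal A^p_\mu$ there is a complex sequence $(a_n)_{n\ge1}$ such that the series $\sum_{n\ge1}a_n n^{-s}$ has abscissa of uniform convergence $$\sigma_u=\inf\Big\{\theta\in\mathbb R:\ \sum_{n\ge 1} a_n n^{-s}\text{ converges uniformly on }\{\Re s>\theta\}\Big\}\le \tfrac12,$$ and $f(s):=\delta_s(f)=\sum_{n=1}^{\infty}a_n n^{-s}$ whenever $\Re s>1/2$; and $f$ is determined by this function: if $\delta_s(f)=\delta_s(g)$ for all $s$ with $\Re s>1/2$, then $f=g$ in $\mathcal A^p_\mu$. -/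

import Mathlib

open MeasureTheory Filter Topology

noncomputable section

namespace DirichletBergman

/-! ### Dirichlet polynomials and Dirichlet series -/

/-- The space of Dirichlet polynomials `P(s) = ∑ aₙ n^{-s}` (finite sum over `n ≥ 1`), given by
their coefficients. -/
abbrev DirichletPoly : Type := ℕ+ →₀ ℂ

/-- The value `P(s) = ∑ aₙ n^{-s}`. -/
def DirichletPoly.eval (P : DirichletPoly) (s : ℂ) : ℂ :=
  P.sum fun n a => a * (n : ℂ) ^ (-s)

/-- The translate `P_σ`, whose coefficients are `aₙ n^{-σ}`. -/
def DirichletPoly.translate (σ : ℝ) (P : DirichletPoly) : DirichletPoly :=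
  P.sum fun n a => Finsupp.single n (a * (n : ℂ) ^ (-(σ : ℂ)))

theorem DirichletPoly.eval_translate (σ : ℝ) (P : DirichletPoly) (s : ℂ) :
    (P.translate σ).eval s = P.eval (σ + s) := by
  unfold DirichletPoly.translate DirichletPoly.eval
  rw [Finsupp.sum_sum_index (by simp) (by intros; ring)]
  refine Finsupp.sum_congr fun n _ => ?_
  rw [Finsupp.sum_single_index (by simp), mul_assoc,
    ← Complex.cpow_add _ _ (by exact_mod_cast n.ne_zero)]
  congr 2
  ring

/-- The partial sum `∑_{n=1}^N aₙ n^{-s}` of a Dirichlet series. -/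
def partialSum (a : ℕ → ℂ) (N : ℕ) (s : ℂ) : ℂ :=
  ∑ n ∈ Finset.Icc 1 N, a n * (n : ℂ) ^ (-s)

/-- The abscissa of uniform convergence `σ_u` of `∑_{n ≥ 1} aₙ n^{-s}`: the infimum of the real `θ`
such that the series converges uniformly on `{s | Re s > θ}` (it is `⊤` if there is none). -/
def abscissaOfUniformConv (a : ℕ → ℂ) : EReal :=
  sInf ((fun θ : ℝ => (θ : EReal)) '' {θ : ℝ | ∃ F : ℂ → ℂ,
    TendstoUniformlyOn (partialSum a) F atTop {s : ℂ | θ < s.re}})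

/-! ### The infinite polytorus and the Hardy norm -/

instance instMeasurableSpaceCircle : MeasurableSpace Circle := borel Circle

instance instBorelSpaceCircle : BorelSpace Circle := ⟨rfl⟩

/-- The infinite-dimensional polytorus, with one coordinate for each prime number. -/
abbrev Polytorus : Type := Nat.Primes → Circle

/-- The normalized Haar measure on the polytorus. -/
def polytorusHaar : Measure Polytorus := Measure.haarMeasure ⊤

instance instIsProbabilityMeasurePolytorusHaar : IsProbabilityMeasure polytorusHaar := by
  constructor
  unfold polytorusHaar
  simpa using Measure.haarMeasure_self (K₀ := (⊤ : TopologicalSpace.PositiveCompacts Polytorus))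

/-- The value at `n` of the completely multiplicative character attached to `χ`: the product of
`χ p` over the prime factors `p` of `n`, counted with multiplicity. -/
def charValue (χ : Polytorus) (n : ℕ+) : Circle :=
  (Multiset.map χ (PNat.factorMultiset n)).prod

theorem charValue_one (χ : Polytorus) : charValue χ 1 = 1 := by
  simp only [charValue, PNat.factorMultiset_one]
  rfl

theorem charValue_mul (χ : Polytorus) (m n : ℕ+) :
    charValue χ (m * n) = charValue χ m * charValue χ n := by
  unfold charValue
  rw [PNat.factorMultiset_mul]
  exact (congrArg Multiset.prod (Multiset.map_add χ _ _)).trans (Multiset.prod_add _ _)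

theorem charValue_prime (χ : Polytorus) (p : Nat.Primes) : charValue χ (p : ℕ+) = χ p := by
  unfold charValue
  rw [PNat.factorMultiset_ofPrime]
  exact (congrArg Multiset.prod (Multiset.map_singleton χ p)).trans (Multiset.prod_singleton _)

theorem continuous_charValue (n : ℕ+) : Continuous fun χ : Polytorus => charValue χ n :=
  continuous_multiset_prod _ fun p _ => continuous_apply p

/-- The Bohr lift `D(P)(χ) = ∑ aₙ χ(n)`, an analytic polynomial on the polytorus. -/
def DirichletPoly.bohrLift (P : DirichletPoly) (χ : Polytorus) : ℂ :=
  P.sum fun n a => a * (charValue χ n : ℂ)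

/-- The Hardy norm `‖P‖_{ℋ^p} = ‖D(P)‖_{L^p(m)}`. -/
def hardyNorm (p : ℝ) (P : DirichletPoly) : ℝ :=
  (∫ χ, ‖P.bohrLift χ‖ ^ p ∂polytorusHaar) ^ (1 / p)

/-! ### The Bergman norm and its completion -/

/-- The Bergman norm `‖P‖_{𝒜^p_μ} = (∫_{[0,∞)} ‖P_σ‖_{ℋ^p}^p dμ(σ))^{1/p}`. -/
def bergmanNorm (p : ℝ) (μ : Measure ℝ) (P : DirichletPoly) : ℝ :=
  (∫ σ in Set.Ici 0, hardyNorm p (P.translate σ) ^ p ∂μ) ^ (1 / p)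

/-- The function `(σ, χ) ↦ D(P_σ)(χ) = ∑ aₙ n^{-σ} χ(n)`. -/
def jointLift (P : DirichletPoly) (x : ℝ × Polytorus) : ℂ :=
  P.sum fun n a => a * (n : ℂ) ^ (-(x.1 : ℂ)) * (charValue x.2 n : ℂ)

theorem bohrLift_translate (P : DirichletPoly) (σ : ℝ) (χ : Polytorus) :
    (P.translate σ).bohrLift χ = jointLift P (σ, χ) := by
  unfold DirichletPoly.translate DirichletPoly.bohrLift jointLift
  rw [Finsupp.sum_sum_index (by simp) (by intros; ring)]
  exact Finsupp.sum_congr fun n _ => Finsupp.sum_single_index (by simp)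

theorem jointLift_add (P Q : DirichletPoly) : jointLift (P + Q) = jointLift P + jointLift Q := by
  funext x
  exact Finsupp.sum_add_index' (by simp) (by intros; ring)

theorem jointLift_smul (c : ℂ) (P : DirichletPoly) : jointLift (c • P) = c • jointLift P := by
  funext x
  unfold jointLift
  rw [Finsupp.sum_smul_index (by simp), Pi.smul_apply, Finsupp.smul_sum]
  refine Finsupp.sum_congr fun n _ => ?_
  simp only [smul_eq_mul]
  ring

theorem continuous_jointLift (P : DirichletPoly) : Continuous (jointLift P) := by
  unfold jointLift Finsupp.sum
  refine continuous_finsetSum _ fun n _ => ?_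
  have hn : (n : ℂ) ≠ 0 := by exact_mod_cast n.ne_zero
  refine (continuous_const.mul ?_).mul ?_
  · exact (Complex.continuous_ofReal.comp continuous_fst).neg.const_cpow (Or.inl hn)
  · exact continuous_subtype_val.comp ((continuous_charValue n).comp continuous_snd)

theorem norm_jointLift_le (P : DirichletPoly) (x : ℝ × Polytorus) (hx : 0 ≤ x.1) :
    ‖jointLift P x‖ ≤ P.sum fun _ a => ‖a‖ := by
  unfold jointLift Finsupp.sum
  refine (norm_sum_le _ _).trans (Finset.sum_le_sum fun n _ => ?_)
  rw [norm_mul, norm_mul, Circle.norm_coe, mul_one]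
  refine mul_le_of_le_one_right (norm_nonneg _) ?_
  have h1 : (1 : ℝ) ≤ (n : ℝ) := by exact_mod_cast n.pos
  have := Complex.norm_cpow_eq_rpow_re_of_pos (lt_of_lt_of_le one_pos h1) (-(x.1 : ℂ))
  rw [show ((n : ℕ) : ℂ) = (((n : ℕ) : ℝ) : ℂ) by push_cast; rfl, this]
  exact Real.rpow_le_one_of_one_le_of_nonpos h1 (by simpa using hx)

/-- The measure `μ|_{[0,∞)} ⊗ m`. -/
def jointMeasure (μ : Measure ℝ) : Measure (ℝ × Polytorus) :=
  (μ.restrict (Set.Ici 0)).prod polytorusHaar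

instance instIsFiniteMeasureJoint (μ : Measure ℝ) [IsFiniteMeasure μ] :
    IsFiniteMeasure (jointMeasure μ) := by
  unfold jointMeasure
  infer_instance

theorem memLp_jointLift (q : ENNReal) (μ : Measure ℝ) [IsFiniteMeasure μ] (P : DirichletPoly) :
    MemLp (jointLift P) q (jointMeasure μ) := by
  refine MemLp.of_bound (continuous_jointLift P).aestronglyMeasurable (P.sum fun _ a => ‖a‖) ?_
  have h : ∀ᵐ σ ∂(μ.restrict (Set.Ici 0)), (0 : ℝ) ≤ σ := ae_restrict_mem measurableSet_Ici
  have h2 : ∀ᵐ x ∂(jointMeasure μ), (0 : ℝ) ≤ x.1 := Measure.quasiMeasurePreserving_fst.ae h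
  exact h2.mono fun x hx => norm_jointLift_le P x hx

theorem bergmanNorm_eq (p : ℝ) (hp : 1 ≤ p) (μ : Measure ℝ) [IsFiniteMeasure μ]
    (P : DirichletPoly) :
    bergmanNorm p μ P = (eLpNorm (jointLift P) (ENNReal.ofReal p) (jointMeasure μ)).toReal := by
  have hp0 : 0 < p := by linarith
  have hm := memLp_jointLift (ENNReal.ofReal p) μ P
  have hq0 : ENNReal.ofReal p ≠ 0 := by simpa using hp0
  rw [hm.eLpNorm_eq_integral_rpow_norm hq0 ENNReal.ofReal_ne_top,
    ENNReal.toReal_ofReal (by positivity), ENNReal.toReal_ofReal hp0.le]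
  have hi : Integrable (fun x => ‖jointLift P x‖ ^ p) (jointMeasure μ) := by
    have := hm.integrable_norm_rpow hq0 ENNReal.ofReal_ne_top
    rwa [ENNReal.toReal_ofReal hp0.le] at this
  unfold jointMeasure at hi ⊢
  rw [integral_prod _ hi]
  unfold bergmanNorm hardyNorm
  rw [one_div]
  congr 2
  funext σ
  rw [← Real.rpow_mul (by positivity), inv_mul_cancel₀ hp0.ne', Real.rpow_one]
  simp_rw [bohrLift_translate]

theorem bergmanNorm_add_le (p : ℝ) (hp : 1 ≤ p) (μ : Measure ℝ) [IsFiniteMeasure μ]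
    (P Q : DirichletPoly) : bergmanNorm p μ (P + Q) ≤ bergmanNorm p μ P + bergmanNorm p μ Q := by
  have hP := memLp_jointLift (ENNReal.ofReal p) μ P
  have hQ := memLp_jointLift (ENNReal.ofReal p) μ Q
  simp only [bergmanNorm_eq p hp]
  rw [← ENNReal.toReal_add hP.eLpNorm_ne_top hQ.eLpNorm_ne_top, jointLift_add]
  refine ENNReal.toReal_mono (ENNReal.add_ne_top.2 ⟨hP.eLpNorm_ne_top, hQ.eLpNorm_ne_top⟩) ?_
  exact eLpNorm_add_le hP.1 hQ.1 (by simpa using hp)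

theorem bergmanNorm_smul (p : ℝ) (hp : 1 ≤ p) (μ : Measure ℝ) [IsFiniteMeasure μ]
    (c : ℂ) (P : DirichletPoly) : bergmanNorm p μ (c • P) = ‖c‖ * bergmanNorm p μ P := by
  simp only [bergmanNorm_eq p hp]
  rw [jointLift_smul, eLpNorm_const_smul, ENNReal.toReal_mul]
  simp

theorem bergmanNorm_nonneg (p : ℝ) (μ : Measure ℝ) (P : DirichletPoly) :
    0 ≤ bergmanNorm p μ P := by
  unfold bergmanNorm hardyNorm
  positivity

/-- The space of Dirichlet polynomials, equipped below with the norm of `𝒜^p_μ`. -/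
def NormedPoly (_p : ℝ) (_μ : Measure ℝ) : Type := DirichletPoly

instance instAddCommGroupNormedPoly (p : ℝ) (μ : Measure ℝ) : AddCommGroup (NormedPoly p μ) :=
  inferInstanceAs (AddCommGroup DirichletPoly)

instance instModuleNormedPoly (p : ℝ) (μ : Measure ℝ) : Module ℂ (NormedPoly p μ) :=
  inferInstanceAs (Module ℂ DirichletPoly)

instance instNormNormedPoly (p : ℝ) (μ : Measure ℝ) : Norm (NormedPoly p μ) :=
  ⟨bergmanNorm p μ⟩

/-- A Dirichlet polynomial as an element of the normed space. -/
def NormedPoly.of (p : ℝ) (μ : Measure ℝ) (P : DirichletPoly) : NormedPoly p μ := P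

theorem normedPoly_core (p : ℝ) [Fact (1 ≤ p)] (μ : Measure ℝ) [IsFiniteMeasure μ] :
    SeminormedSpace.Core ℂ (NormedPoly p μ) where
  norm_nonneg P := bergmanNorm_nonneg p μ P
  norm_smul c P := bergmanNorm_smul p Fact.out μ c P
  norm_triangle P Q := bergmanNorm_add_le p Fact.out μ P Q

instance instSeminormedAddCommGroupNormedPoly (p : ℝ) [Fact (1 ≤ p)] (μ : Measure ℝ)
    [IsFiniteMeasure μ] : SeminormedAddCommGroup (NormedPoly p μ) :=
  SeminormedAddCommGroup.ofCore (normedPoly_core p μ)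

instance instNormedSpaceNormedPoly (p : ℝ) [Fact (1 ≤ p)] (μ : Measure ℝ)
    [IsFiniteMeasure μ] : NormedSpace ℂ (NormedPoly p μ) where
  norm_smul_le c P := (bergmanNorm_smul p Fact.out μ c P).le

/-- The Bergman space `𝒜^p_μ`: the completion of the space of Dirichlet polynomials with respect
to the norm of `𝒜^p_μ`. -/
abbrev BergmanSpace (p : ℝ) [Fact (1 ≤ p)] (μ : Measure ℝ) [IsFiniteMeasure μ] : Type :=
  UniformSpace.Completion (NormedPoly p μ)

/-- A Dirichlet polynomial as an element of `𝒜^p_μ`. -/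
def BergmanSpace.ofPoly (p : ℝ) [Fact (1 ≤ p)] (μ : Measure ℝ) [IsFiniteMeasure μ]
    (P : DirichletPoly) : BergmanSpace p μ :=
  ((NormedPoly.of p μ P : NormedPoly p μ) : UniformSpace.Completion (NormedPoly p μ))

theorem BergmanSpace.norm_ofPoly (p : ℝ) [Fact (1 ≤ p)] (μ : Measure ℝ) [IsFiniteMeasure μ]
    (P : DirichletPoly) : ‖BergmanSpace.ofPoly p μ P‖ = bergmanNorm p μ P :=
  UniformSpace.Completion.norm_coe (NormedPoly.of p μ P)

theorem BergmanSpace.denseRange_ofPoly (p : ℝ) [Fact (1 ≤ p)] (μ : Measure ℝ)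
    [IsFiniteMeasure μ] : DenseRange (BergmanSpace.ofPoly p μ) :=
  UniformSpace.Completion.denseRange_coe (α := NormedPoly p μ)

end DirichletBergman

end

noncomputable section

namespace DirichletBergman

/-! ### A weighted coefficient inequality for polynomials in one variable -/

/-! Everything rests on one estimate: for every `θ > 1/2` there is `C` with `∑ |aₙ| n^{-θ} ≤ C
‖P‖_{𝒜^p_μ}` for all Dirichlet polynomials `P`. It makes coefficients and point evaluations bounded,
so they pass to the completion, and it gives absolute convergence on `Re s > 1/2`, hence uniform
convergence on each `Re s > θ` with `θ > 1/2`.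

For a one-variable polynomial `f = ∑ aₖ zᵏ`, duality gives `∑ xᵏ |aₖ| ≤ c(x) ‖f‖₁` with `c(x) = 1 +
O(x²)` (`sum_pow_mul_norm_coeff_le`). The obvious test function `1 + u`, with `u` built from
negative frequencies, has sup norm only `1 + O(x)`. Subtracting `conj u`, which is invisible to the
analytic `f`, leaves `1 + 2i Im u`, whose modulus is `1 + O(x²)`. Applying this prime by prime with
`x = q^{-θ}` (`sum_norm_mul_prod_le_meanNorm`) costs the product of the `c(q^{-θ})`, bounded since
`∑ q^{-2θ} < ∞`: this is where `1/2` comes from. The result bounds the sum by the `ℋ^1` norm;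
averaging over small `σ`, a set of positive `μ`-mass because `0` lies in the support, replaces that
by the Bergman norm.

Uniqueness has two halves. The function determines the coefficients, by uniqueness of Dirichlet
series. The coefficients determine the element, which is not automatic in a completion: `𝒜^p_μ`
embeds isometrically in `L^p(μ ⊗ m)`, and the Fourier coefficients in `χ`, integrated over any set
of `σ`, are multiples of the `aₙ`. If all `aₙ` vanish, Stone–Weierstrass and a π-λ argument make the
`L^p` function zero (`eq_zero_of_coeffBergman_eq_zero`). -/

theorem sum_primitiveRoot_pow_eq_zero {M : ℕ} {ζ : ℂ} (hζ : IsPrimitiveRoot ζ M) {m : ℕ}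
    (hm : ¬ M ∣ m) : ∑ j ∈ Finset.range M, ζ ^ (j * m) = 0 := by
  have h1 : ζ ^ m ≠ 1 := fun h => hm ((hζ.pow_eq_one_iff_dvd m).1 h)
  have h2 : (∑ j ∈ Finset.range M, (ζ ^ m) ^ j) * (ζ ^ m - 1) = 0 := by
    rw [geom_sum_mul, ← pow_mul, mul_comm m M, pow_mul, hζ.pow_eq_one, one_pow, sub_self]
  have h3 := (mul_eq_zero.1 h2).resolve_right (sub_ne_zero.2 h1)
  simpa [← pow_mul, mul_comm m] using h3

theorem sum_primitiveRoot_pow_mul_conj {M : ℕ} {ζ : ℂ} (hζ : IsPrimitiveRoot ζ M) {k l : ℕ}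
    (hk : k < M) (hl : l < M) :
    ∑ j ∈ Finset.range M, ζ ^ (j * k) * (starRingEnd ℂ) (ζ ^ (j * l)) =
      if k = l then (M : ℂ) else 0 := by
  have hM : M ≠ 0 := by omega
  have hn : ‖ζ‖ = 1 := hζ.norm'_eq_one hM
  have hc : ∀ j, (starRingEnd ℂ) (ζ ^ (j * l)) = ζ ^ (j * (M - l)) := by
    intro j
    have h1 : ζ ^ (j * l) * ζ ^ (j * (M - l)) = 1 := by
      rw [← pow_add, ← mul_add, Nat.add_sub_cancel' hl.le, mul_comm, pow_mul, hζ.pow_eq_one,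
        one_pow]
    have h2 : ζ ^ (j * l) * (starRingEnd ℂ) (ζ ^ (j * l)) = 1 := by
      rw [Complex.mul_conj, Complex.normSq_eq_norm_sq, norm_pow, hn]
      simp
    have h0 : ζ ^ (j * l) ≠ 0 := left_ne_zero_of_mul_eq_one h1
    exact mul_left_cancel₀ h0 (h2.trans h1.symm)
  simp_rw [hc, ← pow_add, ← mul_add]
  split_ifs with h
  · subst h
    rw [Nat.add_sub_cancel' hk.le]
    simp [mul_comm _ M, pow_mul, hζ.pow_eq_one]
  -- The exponent `k + (M - l)` lies strictly between `0` and `2M`, so divisibility by `M` would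
  -- force `k = l`.
  · refine sum_primitiveRoot_pow_eq_zero hζ fun ⟨c, hc⟩ => ?_
    have : c = 1 := by
      have h1 : 0 < M * c := by omega
      have h2 : M * c < M * 2 := by omega
      have := Nat.lt_of_mul_lt_mul_left h2
      have := Nat.pos_of_mul_pos_left h1
      omega
    subst this
    omega

/-- Since `u - conj u = 2i Im u` is orthogonal to `1`, the modulus exceeds `1` only to second order
in `r`. -/
theorem norm_one_add_sub_conj_le {u : ℂ} {r : ℝ} (hu : ‖u‖ ≤ r) :
    ‖1 + u - (starRingEnd ℂ) u‖ ≤ √(1 + 4 * r ^ 2) := by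
  refine Real.le_sqrt_of_sq_le ?_
  rw [← Complex.normSq_eq_norm_sq, Complex.normSq_apply]
  have h1 : |u.im| ≤ r := (Complex.abs_im_le_norm u).trans hu
  have h2 : u.im ^ 2 ≤ r ^ 2 := sq_le_sq' (abs_le.1 h1).1 (abs_le.1 h1).2
  simp
  nlinarith

theorem exists_norm_one_mul_eq_norm (a : ℂ) : ∃ τ : ℂ, ‖τ‖ = 1 ∧ τ * a = ‖a‖ := by
  by_cases h : a = 0
  · exact ⟨1, by simp, by simp [h]⟩
  · have h' : (‖a‖ : ℂ) ≠ 0 := by simpa using h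
    refine ⟨(starRingEnd ℂ) a / ‖a‖, by simp [h], ?_⟩
    rw [div_mul_eq_mul_div, mul_comm, Complex.mul_conj, Complex.normSq_eq_norm_sq]
    field_simp
    push_cast
    ring

/-- The constant in the weighted coefficient inequality. -/
def coeffConst (x : ℝ) : ℝ := √(1 + 4 * (x / (1 - x)) ^ 2)

/-- Pair `f` with `τ (1 + u - conj u)` over the `M`-th roots of unity. The unimodular `τ` and `β k`
rotate the coefficients to their moduli, `1 + u` extracts the weighted sum, and `conj u` contributes
nothing. -/
theorem sum_pow_mul_norm_coeff_le {K M : ℕ} (hM : 2 * K < M) {ζ : ℂ} (hζ : IsPrimitiveRoot ζ M)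
    (a : ℕ → ℂ) {x : ℝ} (hx0 : 0 ≤ x) (hx1 : x < 1) :
    M * ∑ k ∈ Finset.range (K + 1), x ^ k * ‖a k‖ ≤
      coeffConst x * ∑ j ∈ Finset.range M, ‖∑ k ∈ Finset.range (K + 1), a k * ζ ^ (j * k)‖ := by
  obtain ⟨τ, hτ, hτa⟩ := exists_norm_one_mul_eq_norm (a 0)
  choose β hβ hβa using fun k => exists_norm_one_mul_eq_norm (τ * a k)
  set f : ℕ → ℂ := fun j => ∑ k ∈ Finset.range (K + 1), a k * ζ ^ (j * k) with hf
  set b : ℕ → ℂ := fun k => x ^ k * β k with hb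
  set u : ℕ → ℂ := fun j => ∑ l ∈ Finset.Icc 1 K, b l * (starRingEnd ℂ) (ζ ^ (j * l)) with hu
  have hM0 : M ≠ 0 := by omega
  have hζn : ‖ζ‖ = 1 := hζ.norm'_eq_one hM0
  have hun : ∀ j, ‖u j‖ ≤ x / (1 - x) := by
    intro j
    calc ‖u j‖ ≤ ∑ l ∈ Finset.Icc 1 K, x ^ l := by
          refine (norm_sum_le _ _).trans (Finset.sum_le_sum fun l _ => le_of_eq ?_)
          simp [hb, hβ, hζn, abs_of_nonneg hx0]
      _ = x * ∑ l ∈ Finset.range K, x ^ l := by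
          rw [← Finset.Ico_add_one_right_eq_Icc, Finset.sum_Ico_eq_sum_range, Finset.mul_sum]
          refine Finset.sum_congr (by simp) fun l _ => by ring
      _ ≤ x * (1 - x)⁻¹ := by
          refine mul_le_mul_of_nonneg_left ?_ hx0
          rw [← tsum_geometric_of_lt_one hx0 hx1]
          exact (summable_geometric_of_lt_one hx0 hx1).sum_le_tsum _ fun _ _ => by positivity
      _ = x / (1 - x) := rfl
  have h1 : ∑ j ∈ Finset.range M, f j = M * a 0 := by
    rw [hf, Finset.sum_comm]
    simp_rw [← Finset.mul_sum]
    rw [Finset.sum_eq_single_of_mem 0 (by simp)]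
    · simp [mul_comm]
    · intro k hk hk0
      rw [sum_primitiveRoot_pow_eq_zero hζ, mul_zero]
      intro h
      have := Nat.le_of_dvd (Nat.pos_of_ne_zero hk0) h
      simp at hk
      omega
  have h2 : ∑ j ∈ Finset.range M, f j * u j = M * ∑ l ∈ Finset.Icc 1 K, a l * b l := by
    simp_rw [hf, hu, Finset.sum_mul_sum]
    rw [Finset.sum_comm]
    simp_rw [Finset.sum_comm (s := Finset.range M)]
    rw [Finset.sum_comm, Finset.mul_sum]
    refine Finset.sum_congr rfl fun l hl => ?_
    rw [Finset.mem_Icc] at hl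
    have h3 : ∀ k ∈ Finset.range (K + 1), ∑ j ∈ Finset.range M,
        a k * ζ ^ (j * k) * (b l * (starRingEnd ℂ) (ζ ^ (j * l))) =
          if k = l then M * (a l * b l) else 0 := by
      intro k hk
      rw [Finset.mem_range] at hk
      have := sum_primitiveRoot_pow_mul_conj hζ (k := k) (l := l) (by omega) (by omega)
      calc _ = a k * b l * ∑ j ∈ Finset.range M, ζ ^ (j * k) * (starRingEnd ℂ) (ζ ^ (j * l)) := by
            rw [Finset.mul_sum]
            exact Finset.sum_congr rfl fun j _ => by ring
        _ = _ := by
            rw [this]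
            split_ifs with h
            · subst h; ring
            · simp
    rw [Finset.sum_congr rfl h3, Finset.sum_ite_eq', if_pos (Finset.mem_range.2 (by omega))]
  -- All frequencies here are `k + l` with `1 ≤ k + l ≤ 2K < M`, so none is a multiple of `M`; this
  -- is why more than `2K` roots are needed.
  have h3 : ∑ j ∈ Finset.range M, f j * (starRingEnd ℂ) (u j) = 0 := by
    simp_rw [hf, hu, map_sum, Finset.sum_mul_sum]
    rw [Finset.sum_comm]
    simp_rw [Finset.sum_comm (s := Finset.range M)]
    refine Finset.sum_eq_zero fun k hk => Finset.sum_eq_zero fun l hl => ?_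
    rw [Finset.mem_Icc] at hl
    rw [Finset.mem_range] at hk
    have h4 := sum_primitiveRoot_pow_eq_zero hζ (m := k + l) (by
      intro h
      have := Nat.le_of_dvd (by omega) h
      omega)
    calc _ = a k * (starRingEnd ℂ) (b l) * ∑ j ∈ Finset.range M, ζ ^ (j * (k + l)) := by
          rw [Finset.mul_sum]
          refine Finset.sum_congr rfl fun j _ => ?_
          rw [map_mul, Complex.conj_conj, mul_add, pow_add]
          ring
      _ = 0 := by rw [h4, mul_zero]
  have h4 : ((M * ∑ k ∈ Finset.range (K + 1), x ^ k * ‖a k‖ : ℝ) : ℂ) =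
      ∑ j ∈ Finset.range M, f j * (τ * (1 + u j - (starRingEnd ℂ) (u j))) := by
    have h5 : ∑ j ∈ Finset.range M, f j * (τ * (1 + u j - (starRingEnd ℂ) (u j))) =
        τ * (∑ j ∈ Finset.range M, f j + ∑ j ∈ Finset.range M, f j * u j -
          ∑ j ∈ Finset.range M, f j * (starRingEnd ℂ) (u j)) := by
      rw [← Finset.sum_add_distrib, ← Finset.sum_sub_distrib, Finset.mul_sum]
      exact Finset.sum_congr rfl fun j _ => by ring
    rw [h5, h1, h2, h3, sub_zero, ← mul_add, mul_left_comm, mul_add, hτa, Finset.sum_range_succ',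
      ← Finset.Ico_add_one_right_eq_Icc, Finset.sum_Ico_eq_sum_range]
    push_cast
    rw [pow_zero, one_mul, add_comm, Finset.mul_sum]
    congr 2
    refine Finset.sum_congr (by simp) fun l _ => ?_
    have h6 := hβa (l + 1)
    rw [norm_mul, hτ, one_mul] at h6
    simp only [hb]
    rw [← h6, add_comm 1 l]
    ring
  have h5 : ‖((M * ∑ k ∈ Finset.range (K + 1), x ^ k * ‖a k‖ : ℝ) : ℂ)‖ =
      M * ∑ k ∈ Finset.range (K + 1), x ^ k * ‖a k‖ := by
    rw [Complex.norm_real, Real.norm_of_nonneg (by positivity)]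
  rw [← h5, h4, Finset.mul_sum]
  refine (norm_sum_le _ _).trans (Finset.sum_le_sum fun j _ => ?_)
  rw [norm_mul, norm_mul, hτ, one_mul, mul_comm]
  exact mul_le_mul_of_nonneg_right (norm_one_add_sub_conj_le (hun j)) (norm_nonneg _)

theorem one_le_coeffConst (x : ℝ) : 1 ≤ coeffConst x :=
  Real.one_le_sqrt.2 (by nlinarith [sq_nonneg (x / (1 - x))])

theorem coeffConst_le_exp {x : ℝ} (hx : x < 1) (hx2 : x ^ 2 ≤ 1 / 2) :
    coeffConst x ≤ Real.exp (24 * x ^ 2) := by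
  have h1 : x ≤ 0.7072 := by nlinarith
  -- The bound `0.7072` is slightly above `1/√2`, and `(1 - 0.7072)² > 1/12`.
  have h2 : (x / (1 - x)) ^ 2 ≤ 12 * x ^ 2 := by
    rw [div_pow, div_le_iff₀ (by nlinarith)]
    nlinarith [sq_nonneg x, mul_nonneg (sq_nonneg x) (by nlinarith : 0 ≤ 12 * (1 - x) ^ 2 - 1)]
  unfold coeffConst
  rw [Real.sqrt_le_left (Real.exp_pos _).le, ← Real.exp_nat_mul]
  have := Real.add_one_le_exp ((2 : ℕ) * (24 * x ^ 2))
  push_cast at this ⊢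
  linarith

/-! ### Valuations and characters -/

/-- The exponent of the prime `q` in the factorization of `n`. -/
def primeVal (q : Nat.Primes) (n : ℕ+) : ℕ :=
  Multiset.count q (PNat.factorMultiset n : Multiset Nat.Primes)

theorem primeVal_injective {m n : ℕ+} (h : ∀ q, primeVal q m = primeVal q n) : m = n := by
  have h1 : PNat.factorMultiset m = PNat.factorMultiset n := Multiset.ext.2 h
  rw [← PNat.prod_factorMultiset m, h1, PNat.prod_factorMultiset]

theorem charValue_mul_left (χ η : Polytorus) (n : ℕ+) :
    charValue (χ * η) n = charValue χ n * charValue η n :=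
  Multiset.prod_map_mul

theorem charValue_mulSingle (q : Nat.Primes) (z : Circle) (n : ℕ+) :
    charValue (Pi.mulSingle q z) n = z ^ primeVal q n := by
  unfold charValue primeVal
  refine (Multiset.prod_map_eq_pow_single (m := (PNat.factorMultiset n : Multiset Nat.Primes)) q
    (f := Pi.mulSingle (M := fun _ => Circle) q z) fun q' hq' _ => Pi.mulSingle_eq_of_ne (M := fun _ => Circle) hq' z).trans ?_
  rw [Pi.mulSingle_eq_same]

theorem coe_eq_prod_primeVal {S : Finset Nat.Primes} {n : ℕ+}
    (h : ∀ q, q ∉ S → primeVal q n = 0) : (n : ℕ) = ∏ q ∈ S, (q : ℕ) ^ primeVal q n := by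
  have h1 : (n : ℕ) = (Multiset.map (fun q : Nat.Primes => (q : ℕ))
      (PNat.factorMultiset n : Multiset Nat.Primes)).prod := by
    conv_lhs => rw [← PNat.prod_factorMultiset n, PrimeMultiset.coe_prod]
    rfl
  rw [h1]
  refine (Finset.prod_multiset_map_count (PNat.factorMultiset n : Multiset Nat.Primes)
    fun q => (q : ℕ)).trans ?_
  refine Finset.prod_subset (fun q hq => ?_) fun q _ hq => ?_
  · by_contra hS
    exact (Multiset.count_ne_zero.2 (Multiset.mem_toFinset.1 hq)) (h q hS)
  · rw [Multiset.count_eq_zero.2 (fun h => hq (Multiset.mem_toFinset.2 h)), pow_zero]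

/-! ### The mean of a polynomial on the polytorus -/

instance instIsMulLeftInvariantPolytorusHaar : polytorusHaar.IsMulLeftInvariant := by
  unfold polytorusHaar
  infer_instance

/-- The norm `‖P‖_{ℋ^1}`. -/
def meanNorm (P : DirichletPoly) : ℝ := ∫ χ, ‖P.bohrLift χ‖ ∂polytorusHaar

theorem continuous_bohrLift (P : DirichletPoly) : Continuous P.bohrLift := by
  unfold DirichletPoly.bohrLift Finsupp.sum
  exact continuous_finsetSum _ fun n _ =>
    continuous_const.mul (continuous_subtype_val.comp (continuous_charValue n))

theorem integrable_of_continuous {E : Type*} [NormedAddCommGroup E]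
    {f : Polytorus → E} (hf : Continuous f) : Integrable f polytorusHaar :=
  hf.integrable_of_hasCompactSupport (HasCompactSupport.of_compactSpace f)

theorem integrable_norm_bohrLift (P : DirichletPoly) :
    Integrable (fun χ => ‖P.bohrLift χ‖) polytorusHaar :=
  integrable_of_continuous (continuous_bohrLift P).norm

/-- The part of `P` consisting of the terms `aₙ n^{-s}` for which `q` has exponent `k` in `n`. -/
def primePart (q : Nat.Primes) (k : ℕ) (P : DirichletPoly) : DirichletPoly :=
  P.filter fun n => primeVal q n = k

theorem support_primePart (q : Nat.Primes) (k : ℕ) (P : DirichletPoly) :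
    (primePart q k P).support = P.support.filter fun n => primeVal q n = k := by
  classical
  exact (Finsupp.support_filter _ _).trans (by congr)

theorem sum_eq_sum_primePart {E : Type*} [AddCommMonoid E] (q : Nat.Primes) {K : ℕ}
    {P : DirichletPoly} (hK : ∀ n ∈ P.support, primeVal q n ≤ K) (g : ℕ+ → ℂ → E) :
    P.sum g = ∑ k ∈ Finset.range (K + 1), (primePart q k P).sum g := by
  classical
  unfold Finsupp.sum
  rw [← Finset.sum_fiberwise_of_maps_to (t := Finset.range (K + 1)) (g := primeVal q)
    (fun n hn => Finset.mem_range.2 (Nat.lt_succ_of_le (hK n hn)))]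
  refine Finset.sum_congr rfl fun k _ => ?_
  rw [support_primePart]
  refine Finset.sum_congr rfl fun n hn => ?_
  rw [primePart, Finsupp.filter_apply_pos (fun n => primeVal q n = k) _ (Finset.mem_filter.1 hn).2]

/-- Rotating the coordinate `q` alone turns the Bohr lift into a polynomial in the rotation, to
which the one-variable inequality applies. -/
theorem bohrLift_mul_mulSingle (q : Nat.Primes) {K : ℕ} {P : DirichletPoly}
    (hK : ∀ n ∈ P.support, primeVal q n ≤ K) (χ : Polytorus) (z : Circle) :
    P.bohrLift (Pi.mulSingle q z * χ) =
      ∑ k ∈ Finset.range (K + 1), (primePart q k P).bohrLift χ * (z : ℂ) ^ k := by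
  rw [DirichletPoly.bohrLift, sum_eq_sum_primePart q hK]
  refine Finset.sum_congr rfl fun k _ => ?_
  unfold DirichletPoly.bohrLift Finsupp.sum
  rw [Finset.sum_mul]
  refine Finset.sum_congr rfl fun n hn => ?_
  rw [support_primePart, Finset.mem_filter] at hn
  beta_reduce
  rw [charValue_mul_left, charValue_mulSingle, hn.2, Circle.coe_mul, Circle.coe_pow]
  ring

/-- The one-variable inequality is applied at each `χ` and integrated; invariance of Haar measure
makes all `M` rotated means equal. -/
theorem sum_pow_mul_meanNorm_primePart_le (q : Nat.Primes) {K : ℕ} {P : DirichletPoly}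
    (hK : ∀ n ∈ P.support, primeVal q n ≤ K) {x : ℝ} (hx0 : 0 ≤ x) (hx1 : x < 1) :
    ∑ k ∈ Finset.range (K + 1), x ^ k * meanNorm (primePart q k P) ≤
      coeffConst x * meanNorm P := by
  set M : ℕ := 2 * K + 1 with hM
  have hM0 : M ≠ 0 := by omega
  have hζ := Complex.isPrimitiveRoot_exp M hM0
  set ζ : Circle := Circle.exp (2 * Real.pi / M) with hζdef
  have hζc : (ζ : ℂ) = Complex.exp (2 * Real.pi * Complex.I / M) := by
    rw [hζdef, Circle.coe_exp]
    congr 1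
    push_cast
    ring
  rw [← hζc] at hζ
  have h1 : ∀ χ, M * ∑ k ∈ Finset.range (K + 1), x ^ k * ‖(primePart q k P).bohrLift χ‖ ≤
      coeffConst x * ∑ j ∈ Finset.range M, ‖P.bohrLift (Pi.mulSingle q (ζ ^ j) * χ)‖ := by
    intro χ
    refine (sum_pow_mul_norm_coeff_le (by omega) hζ _ hx0 hx1).trans_eq ?_
    simp_rw [bohrLift_mul_mulSingle q hK, Circle.coe_pow, pow_mul]
  have h2 : ∫ χ, M * ∑ k ∈ Finset.range (K + 1), x ^ k * ‖(primePart q k P).bohrLift χ‖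
      ∂polytorusHaar ≤ ∫ χ, coeffConst x *
        ∑ j ∈ Finset.range M, ‖P.bohrLift (Pi.mulSingle q (ζ ^ j) * χ)‖ ∂polytorusHaar := by
    refine integral_mono (integrable_of_continuous ?_) (integrable_of_continuous ?_) h1
    · exact continuous_const.mul (continuous_finsetSum _ fun k _ =>
        continuous_const.mul (continuous_bohrLift _).norm)
    · exact continuous_const.mul (continuous_finsetSum _ fun k _ =>
        ((continuous_bohrLift _).comp (continuous_const.mul continuous_id)).norm)
  rw [integral_const_mul, integral_const_mul, integral_finsetSum _ fun k _ =>
      (integrable_norm_bohrLift _).const_mul _, integral_finsetSum _ fun k _ =>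
      (integrable_norm_bohrLift P).comp_mul_left _] at h2
  simp_rw [integral_const_mul, integral_mul_left_eq_self (μ := polytorusHaar)
    (fun χ => ‖P.bohrLift χ‖)] at h2
  rw [Finset.sum_const, Finset.card_range, nsmul_eq_mul, mul_left_comm] at h2
  exact le_of_mul_le_mul_left h2 (by positivity)

/-- One prime is removed at a time. Exponents outside `S` are asked to agree rather than to vanish,
because this is what `primePart` inherits when `r` leaves `S`. For empty `S` at most one monomial
remains, and its mean norm is the modulus of its coefficient. -/
theorem sum_norm_mul_prod_le_meanNorm (x : Nat.Primes → ℝ) (hx0 : ∀ q, 0 ≤ x q)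
    (hx1 : ∀ q, x q < 1) (S : Finset Nat.Primes) (P : DirichletPoly)
    (hP : ∀ m ∈ P.support, ∀ n ∈ P.support, ∀ q, q ∉ S → primeVal q m = primeVal q n) :
    (P.sum fun n a => ‖a‖ * ∏ q ∈ S, x q ^ primeVal q n) ≤
      (∏ q ∈ S, coeffConst (x q)) * meanNorm P := by
  classical
  induction S using Finset.induction_on generalizing P with
  | empty =>
    rcases P.support.eq_empty_or_nonempty with h | ⟨n, hn⟩
    · rw [Finsupp.support_eq_empty.1 h]
      simp [meanNorm, DirichletPoly.bohrLift]
    · have h1 : P.support = {n} := by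
        refine Finset.eq_singleton_iff_unique_mem.2 ⟨hn, fun m hm => ?_⟩
        exact primeVal_injective fun q => hP m hm n hn q (Finset.notMem_empty q)
      have h2 : ∀ χ, ‖P.bohrLift χ‖ = ‖P n‖ := by
        intro χ
        simp only [DirichletPoly.bohrLift, Finsupp.sum, h1, Finset.sum_singleton, norm_mul]
        rw [Circle.norm_coe, mul_one]
      simp [meanNorm, h2, Finsupp.sum, h1]
  | insert r S hr ih =>
    set K : ℕ := P.support.sup (primeVal r) with hK
    have hK' : ∀ n ∈ P.support, primeVal r n ≤ K := fun n hn => Finset.le_sup hn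
    have hC : 0 ≤ ∏ q ∈ S, coeffConst (x q) :=
      Finset.prod_nonneg fun q _ => zero_le_one.trans (one_le_coeffConst _)
    rw [sum_eq_sum_primePart r hK', Finset.prod_insert hr]
    calc _ = ∑ k ∈ Finset.range (K + 1), x r ^ k *
          (primePart r k P).sum fun n a => ‖a‖ * ∏ q ∈ S, x q ^ primeVal q n := by
          refine Finset.sum_congr rfl fun k _ => ?_
          unfold Finsupp.sum
          rw [Finset.mul_sum]
          refine Finset.sum_congr rfl fun n hn => ?_
          rw [support_primePart, Finset.mem_filter] at hn
          beta_reduce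
          rw [Finset.prod_insert hr, hn.2]
          ring
      _ ≤ ∑ k ∈ Finset.range (K + 1), x r ^ k *
          ((∏ q ∈ S, coeffConst (x q)) * meanNorm (primePart r k P)) := by
          refine Finset.sum_le_sum fun k _ =>
            mul_le_mul_of_nonneg_left (ih _ fun m hm n hn q hq => ?_) (pow_nonneg (hx0 r) k)
          rw [support_primePart, Finset.mem_filter] at hm hn
          by_cases hqr : q = r
          · rw [hqr, hm.2, hn.2]
          · exact hP m hm.1 n hn.1 q (by simp [hqr, hq])
      _ = (∏ q ∈ S, coeffConst (x q)) * ∑ k ∈ Finset.range (K + 1), x r ^ k *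
          meanNorm (primePart r k P) := by
          rw [Finset.mul_sum]
          exact Finset.sum_congr rfl fun k _ => by ring
      _ ≤ (∏ q ∈ S, coeffConst (x q)) * (coeffConst (x r) * meanNorm P) :=
          mul_le_mul_of_nonneg_left
            (sum_pow_mul_meanNorm_primePart_le r hK' (hx0 r) (hx1 r)) hC
      _ = _ := by ring

theorem exists_sum_norm_mul_rpow_le_meanNorm {θ : ℝ} (hθ : 1 / 2 < θ) :
    ∃ C : ℝ, 0 ≤ C ∧ ∀ P : DirichletPoly,
      (P.sum fun n a => ‖a‖ * (n : ℝ) ^ (-θ)) ≤ C * meanNorm P := by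
  classical
  set x : Nat.Primes → ℝ := fun q => ((q : ℕ) : ℝ) ^ (-θ) with hx
  have hx0 : ∀ q, 0 ≤ x q := fun q => by positivity
  have hq : ∀ q : Nat.Primes, (2 : ℝ) ≤ (q : ℕ) := fun q => by exact_mod_cast q.2.two_le
  have hx1 : ∀ q, x q < 1 := fun q =>
    Real.rpow_lt_one_of_one_lt_of_neg (by linarith [hq q]) (by linarith)
  have hxs : ∀ q, x q ^ 2 = ((q : ℕ) : ℝ) ^ (-(2 * θ)) := by
    intro q
    rw [hx, ← Real.rpow_natCast, ← Real.rpow_mul (by positivity)]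
    congr 1
    push_cast
    ring
  have hx2 : ∀ q, x q ^ 2 ≤ 1 / 2 := by
    intro q
    rw [hxs]
    calc ((q : ℕ) : ℝ) ^ (-(2 * θ)) ≤ ((q : ℕ) : ℝ) ^ (-1 : ℝ) :=
          Real.rpow_le_rpow_of_exponent_le (by linarith [hq q]) (by linarith)
      _ ≤ 1 / 2 := by
          rw [Real.rpow_neg_one, one_div]
          exact inv_anti₀ two_pos (hq q)
  have hsum : Summable fun q : Nat.Primes => x q ^ 2 := by
    simp_rw [hxs]
    exact (Real.summable_nat_rpow.2 (by linarith)).comp_injective Subtype.val_injective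
  refine ⟨Real.exp (24 * ∑' q, x q ^ 2), (Real.exp_pos _).le, fun P => ?_⟩
  -- The primes dividing some `n` in the support; the constant above does not depend on `S`.
  set S : Finset Nat.Primes := P.support.biUnion fun n =>
    (PNat.factorMultiset n : Multiset Nat.Primes).toFinset with hS
  have hS0 : ∀ n ∈ P.support, ∀ q, q ∉ S → primeVal q n = 0 := by
    intro n hn q hq
    refine Multiset.count_eq_zero.2 fun h => hq ?_
    exact Finset.mem_biUnion.2 ⟨n, hn, Multiset.mem_toFinset.2 h⟩
  have h1 := sum_norm_mul_prod_le_meanNorm x hx0 hx1 S P fun m hm n hn q hq => by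
    rw [hS0 m hm q hq, hS0 n hn q hq]
  have h2 : (P.sum fun n a => ‖a‖ * (n : ℝ) ^ (-θ)) =
      P.sum fun n a => ‖a‖ * ∏ q ∈ S, x q ^ primeVal q n := by
    refine Finsupp.sum_congr fun n hn => ?_
    congr 1
    conv_lhs => rw [coe_eq_prod_primeVal (hS0 n hn)]
    push_cast
    rw [← Real.finsetProd_rpow _ _ fun q _ => by positivity]
    refine Finset.prod_congr rfl fun q _ => ?_
    rw [hx, ← Real.rpow_natCast, ← Real.rpow_natCast, ← Real.rpow_mul (by positivity),
      ← Real.rpow_mul (by positivity), mul_comm]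
  rw [h2]
  refine h1.trans (mul_le_mul_of_nonneg_right ?_ (integral_nonneg fun _ => norm_nonneg _))
  calc ∏ q ∈ S, coeffConst (x q) ≤ ∏ q ∈ S, Real.exp (24 * x q ^ 2) :=
        Finset.prod_le_prod (fun q _ => zero_le_one.trans (one_le_coeffConst _))
          fun q _ => coeffConst_le_exp (hx1 q) (hx2 q)
    _ = Real.exp (24 * ∑ q ∈ S, x q ^ 2) := by rw [← Real.exp_sum, Finset.mul_sum]
    _ ≤ _ := by
        refine Real.exp_le_exp.2 (mul_le_mul_of_nonneg_left ?_ (by norm_num))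
        exact hsum.sum_le_tsum _ fun _ _ => sq_nonneg _

/-! ### Absolute convergence in terms of the Bergman norm -/

theorem translate_apply (σ : ℝ) (P : DirichletPoly) (n : ℕ+) :
    P.translate σ n = P n * (n : ℂ) ^ (-(σ : ℂ)) := by
  unfold DirichletPoly.translate Finsupp.sum
  rw [Finsupp.finsetSum_apply]
  simp only [Finsupp.single_apply, Finset.sum_ite_eq', Finsupp.mem_support_iff, ne_eq, ite_not]
  split_ifs with h
  · simp [h]
  · rfl

theorem norm_pnat_cpow (n : ℕ+) (s : ℂ) : ‖((n : ℕ) : ℂ) ^ s‖ = ((n : ℕ) : ℝ) ^ s.re :=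
  Complex.norm_natCast_cpow_of_pos n.pos s

theorem sum_norm_mul_rpow_le_translate (P : DirichletPoly) {σ ε : ℝ} (hσ : σ ≤ ε) (θ : ℝ) :
    (P.sum fun n a => ‖a‖ * (n : ℝ) ^ (-(θ + ε))) ≤
      (P.translate σ).sum fun n a => ‖a‖ * (n : ℝ) ^ (-θ) := by
  have h1 : (P.translate σ).support ⊆ P.support := by
    intro n hn
    rw [Finsupp.mem_support_iff, translate_apply] at hn
    exact Finsupp.mem_support_iff.2 (left_ne_zero_of_mul hn)
  rw [Finsupp.sum_of_support_subset _ h1 _ (by simp)]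
  refine Finset.sum_le_sum fun n _ => ?_
  have hn : (1 : ℝ) ≤ (n : ℕ) := by exact_mod_cast n.pos
  rw [translate_apply, norm_mul, norm_pnat_cpow, mul_assoc,
    ← Real.rpow_add (by positivity)]
  refine mul_le_mul_of_nonneg_left (Real.rpow_le_rpow_of_exponent_le hn ?_) (norm_nonneg _)
  simp only [Complex.neg_re, Complex.ofReal_re]
  linarith

theorem integral_norm_jointLift_le_bergmanNorm (p : ℝ) (hp : 1 ≤ p) (μ : Measure ℝ)
    [IsProbabilityMeasure μ] (hμ : μ (Set.Iio 0) = 0) (P : DirichletPoly) :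
    ∫ x, ‖jointLift P x‖ ∂(jointMeasure μ) ≤ bergmanNorm p μ P := by
  have h1 : IsProbabilityMeasure (μ.restrict (Set.Ici 0)) := by
    constructor
    rw [Measure.restrict_apply_univ, ← Set.compl_Iio, prob_compl_eq_one_iff measurableSet_Iio, hμ]
  have h2 : IsProbabilityMeasure (jointMeasure μ) := by
    unfold jointMeasure
    infer_instance
  have hm := memLp_jointLift (ENNReal.ofReal p) μ P
  rw [bergmanNorm_eq p hp, integral_norm_eq_lintegral_enorm hm.1, ← eLpNorm_one_eq_lintegral_enorm]
  exact ENNReal.toReal_mono hm.eLpNorm_ne_top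
    (eLpNorm_le_eLpNorm_of_exponent_le (by simpa using hp) hm.1)

/-- For `σ ≤ ε` the `ℋ^1` estimate for `P_σ` at exponent `θ - ε` controls the sum at `θ`.
Integrating over these `σ` and comparing `L^1` with `L^p` on a probability space finishes. -/
theorem exists_sum_norm_mul_rpow_le_bergmanNorm (p : ℝ) (hp : 1 ≤ p) (μ : Measure ℝ)
    [IsProbabilityMeasure μ] (hμ : μ (Set.Iio 0) = 0) (h0 : (0 : ℝ) ∈ μ.support)
    {θ : ℝ} (hθ : 1 / 2 < θ) :
    ∃ C : ℝ, 0 ≤ C ∧ ∀ P : DirichletPoly,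
      (P.sum fun n a => ‖a‖ * (n : ℝ) ^ (-θ)) ≤ C * bergmanNorm p μ P := by
  -- Half of the gap, so that `θ - ε` is still above `1/2`.
  set ε := (θ - 1 / 2) / 2 with hε
  have hε0 : 0 < ε := by rw [hε]; linarith
  obtain ⟨C, hC0, hC⟩ := exists_sum_norm_mul_rpow_le_meanNorm (θ := θ - ε) (by rw [hε]; linarith)
  set ν := μ.restrict (Set.Ici 0) with hν
  have hνμ : ν = μ := Measure.restrict_eq_self_of_ae_mem (by
    rw [ae_iff]
    simpa [Set.Iio_def] using hμ)
  set c : ℝ := ν.real (Set.Iic ε) with hc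
  have hc0 : 0 < c := by
    rw [hc, Measure.real, hνμ]
    refine ENNReal.toReal_pos (ne_of_gt ?_) (measure_ne_top _ _)
    exact (Measure.mem_support_iff_forall _).1 h0 _ (Iic_mem_nhds hε0)
  refine ⟨c⁻¹ * C, by positivity, fun P => ?_⟩
  set A := P.sum fun n a => ‖a‖ * (n : ℝ) ^ (-θ) with hA
  have hi : Integrable (fun x => ‖jointLift P x‖) (ν.prod polytorusHaar) :=
    ((memLp_jointLift 1 μ P).integrable le_rfl).norm
  have hm : ∀ σ, meanNorm (P.translate σ) = ∫ χ, ‖jointLift P (σ, χ)‖ ∂polytorusHaar := by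
    intro σ
    unfold meanNorm
    simp_rw [bohrLift_translate]
  have h1 : ∀ σ ∈ Set.Iic ε, A ≤ C * meanNorm (P.translate σ) := by
    intro σ hσ
    have := sum_norm_mul_rpow_le_translate P hσ (θ - ε)
    rw [sub_add_cancel] at this
    exact this.trans (hC _)
  have hi2 : Integrable (fun σ => C * meanNorm (P.translate σ)) ν := by
    simp_rw [hm]
    exact hi.integral_prod_left.const_mul C
  have h2 : c * A ≤ C * bergmanNorm p μ P := by
    calc c * A = ∫ σ in Set.Iic ε, A ∂ν := by simp [hc, Measure.real]
      _ ≤ ∫ σ in Set.Iic ε, C * meanNorm (P.translate σ) ∂ν :=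
          setIntegral_mono_on (integrable_const _) hi2.integrableOn measurableSet_Iic h1
      _ ≤ ∫ σ, C * meanNorm (P.translate σ) ∂ν :=
          setIntegral_le_integral hi2 (Eventually.of_forall fun σ =>
            mul_nonneg hC0 (integral_nonneg fun _ => norm_nonneg _))
      _ = C * ∫ x, ‖jointLift P x‖ ∂(jointMeasure μ) := by
          rw [integral_const_mul, jointMeasure, integral_prod _ hi]
          simp_rw [hm]
      _ ≤ C * bergmanNorm p μ P :=
          mul_le_mul_of_nonneg_left (integral_norm_jointLift_le_bergmanNorm p hp μ hμ P) hC0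
  rw [mul_assoc, ← div_eq_inv_mul, le_div_iff₀ hc0, mul_comm]
  exact h2

/-! ### Coefficients and point evaluations on the Bergman space -/

section Extension

variable (p : ℝ) [Fact (1 ≤ p)] (μ : Measure ℝ)

/-- The inclusion of the Dirichlet polynomials in the Bergman space, as a linear map. -/
def ofPolyLin [IsFiniteMeasure μ] : DirichletPoly →ₗ[ℂ] BergmanSpace p μ where
  toFun := BergmanSpace.ofPoly p μ
  map_add' P Q := UniformSpace.Completion.coe_add (NormedPoly.of p μ P) (NormedPoly.of p μ Q)
  map_smul' c P := UniformSpace.Completion.coe_smul c (NormedPoly.of p μ P)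

theorem denseRange_ofPolyLin [IsFiniteMeasure μ] : DenseRange (ofPolyLin p μ) :=
  BergmanSpace.denseRange_ofPoly p μ

theorem norm_ofPolyLin [IsFiniteMeasure μ] (P : DirichletPoly) :
    ‖ofPolyLin p μ P‖ = bergmanNorm p μ P :=
  BergmanSpace.norm_ofPoly p μ P

/-- The evaluation `P ↦ P(s)` as a linear form. -/
def evalLin (s : ℂ) : DirichletPoly →ₗ[ℂ] ℂ :=
  Finsupp.lsum ℂ fun n : ℕ+ => LinearMap.mulRight ℂ ((n : ℂ) ^ (-s))

theorem evalLin_apply (s : ℂ) (P : DirichletPoly) : evalLin s P = P.eval s := rfl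

/-- The extension of `P ↦ P(s)` to the Bergman space. -/
def evalBergman [IsFiniteMeasure μ] (s : ℂ) : BergmanSpace p μ →L[ℂ] ℂ :=
  (evalLin s).extendOfNorm (ofPolyLin p μ)

/-- The extension of the `n`-th coefficient to the Bergman space. -/
def coeffBergman [IsFiniteMeasure μ] (n : ℕ+) : BergmanSpace p μ →L[ℂ] ℂ :=
  (Finsupp.lapply n : DirichletPoly →ₗ[ℂ] ℂ).extendOfNorm (ofPolyLin p μ)

variable [IsProbabilityMeasure μ] (hμ : μ (Set.Iio 0) = 0) (h0 : (0 : ℝ) ∈ μ.support)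

include hμ h0

/-- With a fixed finite `F` in place of the support, both sides are continuous in the element, so
the inequality survives passage to the completion. -/
theorem exists_sum_norm_mul_rpow_le_norm {θ : ℝ} (hθ : 1 / 2 < θ) :
    ∃ C : ℝ, 0 ≤ C ∧ ∀ P : DirichletPoly, ∀ F : Finset ℕ+,
      ∑ n ∈ F, ‖P n‖ * (n : ℝ) ^ (-θ) ≤ C * ‖ofPolyLin p μ P‖ := by
  obtain ⟨C, hC0, hC⟩ := exists_sum_norm_mul_rpow_le_bergmanNorm p Fact.out μ hμ h0 hθ
  refine ⟨C, hC0, fun P F => ?_⟩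
  rw [norm_ofPolyLin]
  refine le_trans ?_ (hC P)
  classical
  rw [Finsupp.sum_of_support_subset P (Finset.subset_union_left (s₂ := F)) _ (by simp)]
  exact Finset.sum_le_sum_of_subset_of_nonneg Finset.subset_union_right
    fun n _ _ => by positivity

theorem coeffBergman_ofPolyLin (n : ℕ+) (P : DirichletPoly) :
    coeffBergman p μ n (ofPolyLin p μ P) = P n := by
  refine LinearMap.extendOfNorm_eq (denseRange_ofPolyLin p μ) ?_ P
  obtain ⟨C, -, hC⟩ := exists_sum_norm_mul_rpow_le_norm p μ hμ h0 (θ := 1) (by norm_num)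
  refine ⟨(n : ℝ) * C, fun Q => ?_⟩
  have h1 := hC Q {n}
  have hn : (0 : ℝ) < (n : ℕ) := by exact_mod_cast n.pos
  rw [Finset.sum_singleton, Real.rpow_neg_one, ← div_eq_mul_inv, div_le_iff₀ hn] at h1
  rw [Finsupp.lapply_apply]
  linarith

theorem exists_sum_norm_coeffBergman_le {θ : ℝ} (hθ : 1 / 2 < θ) :
    ∃ C : ℝ, 0 ≤ C ∧ ∀ f : BergmanSpace p μ, ∀ F : Finset ℕ+,
      ∑ n ∈ F, ‖coeffBergman p μ n f‖ * (n : ℝ) ^ (-θ) ≤ C * ‖f‖ := by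
  obtain ⟨C, hC0, hC⟩ := exists_sum_norm_mul_rpow_le_norm p μ hμ h0 hθ
  refine ⟨C, hC0, fun f F => ?_⟩
  refine isClosed_property (denseRange_ofPolyLin p μ)
    (p := fun f => ∑ n ∈ F, ‖coeffBergman p μ n f‖ * (n : ℝ) ^ (-θ) ≤ C * ‖f‖)
    (isClosed_le (by fun_prop) (by fun_prop)) (fun P => ?_) f
  simp_rw [coeffBergman_ofPolyLin p μ hμ h0]
  exact hC P F

theorem summable_norm_coeffBergman {θ : ℝ} (hθ : 1 / 2 < θ) (f : BergmanSpace p μ) :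
    Summable fun n : ℕ+ => ‖coeffBergman p μ n f‖ * (n : ℝ) ^ (-θ) := by
  obtain ⟨C, -, hC⟩ := exists_sum_norm_coeffBergman_le p μ hμ h0 hθ
  exact summable_of_sum_le (fun n => by positivity) (hC f)

theorem evalBergman_ofPolyLin {s : ℂ} (hs : 1 / 2 < s.re) (P : DirichletPoly) :
    evalBergman p μ s (ofPolyLin p μ P) = P.eval s := by
  refine LinearMap.extendOfNorm_eq (denseRange_ofPolyLin p μ) ?_ P
  obtain ⟨C, -, hC⟩ := exists_sum_norm_mul_rpow_le_norm p μ hμ h0 hs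
  refine ⟨C, fun Q => le_trans ?_ (hC Q Q.support)⟩
  rw [evalLin_apply]
  refine (norm_sum_le _ _).trans_eq (Finset.sum_congr rfl fun n _ => ?_)
  rw [norm_mul, norm_pnat_cpow, Complex.neg_re]

/-- The sum of the series is itself a bounded functional, by the absolute estimate, and it agrees
with the evaluation on the dense subspace of polynomials. -/
theorem hasSum_coeffBergman {s : ℂ} (hs : 1 / 2 < s.re) (f : BergmanSpace p μ) :
    HasSum (fun n : ℕ+ => coeffBergman p μ n f * (n : ℂ) ^ (-s)) (evalBergman p μ s f) := by
  have hnorm : ∀ f : BergmanSpace p μ, ∀ n : ℕ+, ‖coeffBergman p μ n f * ((n : ℕ) : ℂ) ^ (-s)‖ =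
      ‖coeffBergman p μ n f‖ * (n : ℝ) ^ (-s.re) := fun f n => by
    rw [norm_mul, norm_pnat_cpow, Complex.neg_re]
  have hsum : ∀ f : BergmanSpace p μ,
      Summable fun n : ℕ+ => ‖coeffBergman p μ n f * ((n : ℕ) : ℂ) ^ (-s)‖ := fun f => by
    simp_rw [hnorm]
    exact summable_norm_coeffBergman p μ hμ h0 hs f
  obtain ⟨C, hC0, hC⟩ := exists_sum_norm_coeffBergman_le p μ hμ h0 hs
  let g : BergmanSpace p μ →L[ℂ] ℂ := LinearMap.mkContinuous
    { toFun := fun f => ∑' n : ℕ+, coeffBergman p μ n f * ((n : ℕ) : ℂ) ^ (-s)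
      map_add' := fun f₁ f₂ => by
        simp_rw [map_add, add_mul]
        exact (hsum f₁).of_norm.tsum_add (hsum f₂).of_norm
      map_smul' := fun c f => by
        simp_rw [map_smul, smul_eq_mul, mul_assoc]
        exact tsum_mul_left } C fun f => by
    refine (norm_tsum_le_tsum_norm (hsum f)).trans ?_
    simp_rw [hnorm]
    exact (summable_norm_coeffBergman p μ hμ h0 hs f).tsum_le_of_sum_le (hC f)
  have hg : ⇑(evalBergman p μ s) = g := by
    refine (denseRange_ofPolyLin p μ).equalizer (by fun_prop) (by fun_prop) (funext fun P => ?_)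
    rw [Function.comp_apply, Function.comp_apply, evalBergman_ofPolyLin p μ hμ h0 hs]
    change _ = ∑' n : ℕ+, coeffBergman p μ n (ofPolyLin p μ P) * ((n : ℕ) : ℂ) ^ (-s)
    simp_rw [coeffBergman_ofPolyLin p μ hμ h0]
    rw [tsum_eq_sum (s := P.support)]
    · rfl
    · intro n hn
      rw [Finsupp.notMem_support_iff.1 hn, zero_mul]
  rw [hg]
  exact (hsum f).of_norm.hasSum

end Extension

/-! ### The Dirichlet series of an element of the Bergman space -/

/-- The coefficients of an element of the Bergman space. -/
def coeffSeq (p : ℝ) [Fact (1 ≤ p)] (μ : Measure ℝ) [IsFiniteMeasure μ] (f : BergmanSpace p μ)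
    (n : ℕ) : ℂ :=
  if h : 0 < n then coeffBergman p μ ⟨n, h⟩ f else 0

section Series

variable (p : ℝ) [Fact (1 ≤ p)] (μ : Measure ℝ)

theorem coeffSeq_zero [IsFiniteMeasure μ] (f : BergmanSpace p μ) : coeffSeq p μ f 0 = 0 := by
  simp [coeffSeq]

theorem coeffSeq_pnat [IsFiniteMeasure μ] (f : BergmanSpace p μ) (n : ℕ+) :
    coeffSeq p μ f n = coeffBergman p μ n f := by
  rw [coeffSeq, dif_pos n.pos]
  rfl

theorem notMem_range_pnat {n : ℕ} (hn : n ∉ Set.range ((↑) : ℕ+ → ℕ)) : n = 0 := by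
  by_contra h
  exact hn ⟨⟨n, Nat.pos_of_ne_zero h⟩, rfl⟩

theorem partialSum_eq_sum_range {a : ℕ → ℂ} (ha : a 0 = 0) (N : ℕ) (s : ℂ) :
    partialSum a N s = ∑ n ∈ Finset.range (N + 1), a n * (n : ℂ) ^ (-s) := by
  rw [partialSum, Finset.sum_range_eq_add_Ico _ (Nat.succ_pos N), ha, zero_mul, zero_add,
    Nat.succ_eq_add_one, Finset.Ico_add_one_right_eq_Icc]

variable [IsProbabilityMeasure μ] (hμ : μ (Set.Iio 0) = 0) (h0 : (0 : ℝ) ∈ μ.support)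

include hμ h0

theorem summable_norm_coeffSeq {θ : ℝ} (hθ : 1 / 2 < θ) (f : BergmanSpace p μ) :
    Summable fun n : ℕ => ‖coeffSeq p μ f n‖ * (n : ℝ) ^ (-θ) := by
  refine (PNat.coe_injective.summable_iff fun n hn => ?_).1 ?_
  · rw [notMem_range_pnat hn, coeffSeq_zero, norm_zero, zero_mul]
  · refine (summable_norm_coeffBergman p μ hμ h0 hθ f).congr fun n => ?_
    rw [Function.comp_apply, coeffSeq_pnat]

theorem hasSum_coeffSeq {s : ℂ} (hs : 1 / 2 < s.re) (f : BergmanSpace p μ) :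
    HasSum (fun n : ℕ => coeffSeq p μ f n * (n : ℂ) ^ (-s)) (evalBergman p μ s f) := by
  refine (PNat.coe_injective.hasSum_iff fun n hn => ?_).1 ?_
  · rw [notMem_range_pnat hn, coeffSeq_zero, zero_mul]
  · convert hasSum_coeffBergman p μ hμ h0 hs f using 2 with n
    rw [Function.comp_apply, coeffSeq_pnat]

theorem tendsto_partialSum_coeffSeq {s : ℂ} (hs : 1 / 2 < s.re) (f : BergmanSpace p μ) :
    Tendsto (fun N : ℕ => partialSum (coeffSeq p μ f) N s) atTop (𝓝 (evalBergman p μ s f)) := by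
  simp_rw [partialSum_eq_sum_range (coeffSeq_zero p μ f)]
  exact (hasSum_coeffSeq p μ hμ h0 hs f).tendsto_sum_nat.comp (tendsto_add_atTop_nat 1)

/-- Weierstrass M-test on `Re s > θ` with majorant `|aₙ| n^{-θ}`, for real `θ > 1/2` arbitrarily
close to `1/2`. -/
theorem abscissaOfUniformConv_coeffSeq_le (f : BergmanSpace p μ) :
    abscissaOfUniformConv (coeffSeq p μ f) ≤ ((1 / 2 : ℝ) : EReal) := by
  refine le_of_forall_gt_imp_ge_of_dense fun c hc => ?_
  obtain ⟨θ, hθ, hθc⟩ := EReal.lt_iff_exists_real_btwn.1 hc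
  refine le_trans (sInf_le ⟨θ, ⟨fun s => ∑' n : ℕ, coeffSeq p μ f n * (n : ℂ) ^ (-s), ?_⟩, rfl⟩)
    hθc.le
  · have h1 := tendstoUniformlyOn_tsum_nat (s := {s : ℂ | θ < s.re})
      (f := fun (n : ℕ) (s : ℂ) => coeffSeq p μ f n * (n : ℂ) ^ (-s))
      (summable_norm_coeffSeq p μ hμ h0 (EReal.coe_lt_coe_iff.1 hθ) f) fun n s hs => ?_
    · intro v hv
      have h2 := (tendsto_add_atTop_nat 1).eventually (h1 v hv)
      simp_rw [partialSum_eq_sum_range (coeffSeq_zero p μ f)]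
      exact h2
    · rcases Nat.eq_zero_or_pos n with rfl | hn
      · simp [coeffSeq_zero]
      · rw [norm_mul, Complex.norm_natCast_cpow_of_pos hn, Complex.neg_re]
        refine mul_le_mul_of_nonneg_left
          (Real.rpow_le_rpow_of_exponent_le (by exact_mod_cast hn) ?_) (norm_nonneg _)
        have hs' : θ < s.re := hs
        exact neg_le_neg hs'.le

theorem coeffBergman_eq_zero_of_evalBergman_eq_zero {f : BergmanSpace p μ}
    (hf : ∀ s : ℂ, 1 / 2 < s.re → evalBergman p μ s f = 0) (n : ℕ+) :
    coeffBergman p μ n f = 0 := by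
  have hterm : ∀ s : ℂ, LSeries.term (coeffSeq p μ f) s =
      fun n : ℕ => coeffSeq p μ f n * (n : ℂ) ^ (-s) := by
    intro s
    funext n
    rcases eq_or_ne n 0 with rfl | hn
    · simp [coeffSeq_zero]
    · rw [LSeries.term_of_ne_zero hn, Complex.cpow_neg, div_eq_mul_inv]
  have h1 : (fun x : ℝ => LSeries (coeffSeq p μ f) x) =ᶠ[atTop] 0 := by
    filter_upwards [eventually_gt_atTop (1 / 2 : ℝ)] with x hx
    have hx' : 1 / 2 < (x : ℂ).re := by simpa using hx
    rw [LSeries, hterm, (hasSum_coeffSeq p μ hμ h0 hx' f).tsum_eq, hf _ hx']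
    rfl
  have h2 : LSeries.abscissaOfAbsConv (coeffSeq p μ f) ≠ ⊤ := by
    have h3 : LSeriesSummable (coeffSeq p μ f) 1 := by
      rw [LSeriesSummable, hterm]
      exact (hasSum_coeffSeq p μ hμ h0 (by norm_num) f).summable
    exact ne_top_of_le_ne_top (EReal.coe_ne_top _) h3.abscissaOfAbsConv_le
  have h4 := (LSeries_eventually_eq_zero_iff'.1 h1).resolve_right h2 n n.ne_zero
  rwa [coeffSeq_pnat] at h4

end Series

/-! ### Rational characters of the polytorus -/

/-- The continuous function `χ ↦ χ(m) * conj χ(n)`. -/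
def ratChar (m n : ℕ+) : C(Polytorus, ℂ) where
  toFun χ := (charValue χ m : ℂ) * (starRingEnd ℂ) (charValue χ n : ℂ)
  continuous_toFun := by
    have h : ∀ n, Continuous fun χ : Polytorus => (charValue χ n : ℂ) := fun n =>
      continuous_subtype_val.comp (continuous_charValue n)
    exact (h m).mul (Complex.continuous_conj.comp (h n))

theorem ratChar_apply (m n : ℕ+) (χ : Polytorus) :
    ratChar m n χ = (charValue χ m : ℂ) * (starRingEnd ℂ) (charValue χ n : ℂ) := rfl

theorem norm_ratChar_apply (m n : ℕ+) (χ : Polytorus) : ‖ratChar m n χ‖ = 1 := by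
  rw [ratChar_apply, norm_mul, RCLike.norm_conj, Circle.norm_coe, Circle.norm_coe, one_mul]

theorem ratChar_mul (k l m n : ℕ+) : ratChar k l * ratChar m n = ratChar (k * m) (l * n) := by
  ext χ
  rw [ContinuousMap.mul_apply, ratChar_apply, ratChar_apply, ratChar_apply, charValue_mul,
    charValue_mul, Circle.coe_mul, Circle.coe_mul, map_mul]
  ring

theorem ratChar_one : ratChar 1 1 = 1 := by
  ext χ
  rw [ratChar_apply, charValue_one]
  simp

/-- Rotating a coordinate `q` at which `m` and `n` have different valuations multiplies the
integrand by `w ≠ 1` but preserves the integral. The order `M` of `ζ` exceeds both valuations, which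
keeps their powers distinct. -/
theorem integral_ratChar {m n : ℕ+} (h : m ≠ n) : ∫ χ, ratChar m n χ ∂polytorusHaar = 0 := by
  obtain ⟨q, hq⟩ : ∃ q, primeVal q m ≠ primeVal q n := by
    by_contra! hq
    exact h (primeVal_injective hq)
  set M := primeVal q m + primeVal q n + 1 with hM
  have hζ := Complex.isPrimitiveRoot_exp M (by omega)
  set ζ : Circle := Circle.exp (2 * Real.pi / M) with hζdef
  have hζc : (ζ : ℂ) = Complex.exp (2 * Real.pi * Complex.I / M) := by
    rw [hζdef, Circle.coe_exp]
    congr 1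
    push_cast
    ring
  rw [← hζc] at hζ
  set w : ℂ := (ζ : ℂ) ^ primeVal q m * (starRingEnd ℂ) ((ζ : ℂ) ^ primeVal q n) with hw
  have h1 : ∀ χ, ratChar m n (Pi.mulSingle q ζ * χ) = w * ratChar m n χ := by
    intro χ
    rw [ratChar_apply, ratChar_apply, charValue_mul_left, charValue_mul_left, charValue_mulSingle,
      charValue_mulSingle, Circle.coe_mul, Circle.coe_mul, Circle.coe_pow, Circle.coe_pow, map_mul,
      hw]
    ring
  have hw1 : w ≠ 1 := by
    intro hw1
    refine hq (hζ.pow_inj (by omega) (by omega) ?_)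
    have h2 : (ζ : ℂ) ^ primeVal q n * (starRingEnd ℂ) ((ζ : ℂ) ^ primeVal q n) = 1 := by
      rw [Complex.mul_conj, Complex.normSq_eq_norm_sq, norm_pow, Circle.norm_coe]
      simp
    exact mul_right_cancel₀ (right_ne_zero_of_mul_eq_one h2) (hw1.trans h2.symm)
  have h3 := integral_mul_left_eq_self (μ := polytorusHaar) (fun χ => ratChar m n χ)
    (Pi.mulSingle q ζ)
  simp_rw [h1] at h3
  rw [integral_const_mul] at h3
  have h4 : (w - 1) * ∫ χ, ratChar m n χ ∂polytorusHaar = 0 := by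
    rw [sub_mul, one_mul, h3, sub_self]
  exact (mul_eq_zero.1 h4).resolve_left (sub_ne_zero.2 hw1)

/-- The star subalgebra of `C(𝕋^∞, ℂ)` generated by the rational characters. -/
def ratCharSubalgebra : StarSubalgebra ℂ C(Polytorus, ℂ) where
  toSubalgebra := Algebra.adjoin ℂ (Set.range fun x : ℕ+ × ℕ+ => ratChar x.1 x.2)
  star_mem' := by
    change Algebra.adjoin ℂ (Set.range fun x : ℕ+ × ℕ+ => ratChar x.1 x.2) ≤
      star (Algebra.adjoin ℂ (Set.range fun x : ℕ+ × ℕ+ => ratChar x.1 x.2))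
    refine Algebra.adjoin_le ?_
    rintro _ ⟨⟨m, n⟩, rfl⟩
    refine Algebra.subset_adjoin ⟨⟨n, m⟩, ?_⟩
    ext χ
    rw [ContinuousMap.star_apply, ratChar_apply, ratChar_apply, ← starRingEnd_apply, map_mul,
      Complex.conj_conj, mul_comm]

theorem ratCharSubalgebra_toSubmodule :
    ratCharSubalgebra.toSubalgebra.toSubmodule =
      Submodule.span ℂ (Set.range fun x : ℕ+ × ℕ+ => ratChar x.1 x.2) := by
  apply Algebra.adjoin_eq_span_of_subset
  refine Set.Subset.trans
    (fun x => Submonoid.closure_induction (fun _ => id) ⟨(1, 1), ratChar_one⟩ ?_)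
    Submodule.subset_span
  rintro _ _ _ _ ⟨⟨k, l⟩, rfl⟩ ⟨⟨m, n⟩, rfl⟩
  exact ⟨(k * m, l * n), (ratChar_mul k l m n).symm⟩

theorem ratCharSubalgebra_separatesPoints : ratCharSubalgebra.SeparatesPoints := by
  intro x y hxy
  obtain ⟨q, hq⟩ := Function.ne_iff.1 hxy
  refine ⟨_, ⟨ratChar q 1, Algebra.subset_adjoin ⟨(q, 1), rfl⟩, rfl⟩, ?_⟩
  have h1 : ∀ χ : Polytorus, ratChar q 1 χ = χ q := fun χ => by
    rw [ratChar_apply, charValue_prime, charValue_one, Circle.coe_one, map_one, mul_one]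
  intro h
  exact hq (Circle.coe_injective ((h1 x).symm.trans (h.trans (h1 y))))

/-- Stone–Weierstrass: the span of the rational characters is a point-separating star subalgebra,
hence dense. -/
theorem eq_zero_of_forall_ratChar {ψ : C(Polytorus, ℂ) →L[ℂ] ℂ}
    (hψ : ∀ m n, ψ (ratChar m n) = 0) (φ : C(Polytorus, ℂ)) : ψ φ = 0 := by
  have h1 : Dense (ratCharSubalgebra : Set C(Polytorus, ℂ)) := by
    rw [dense_iff_closure_eq]
    have := ContinuousMap.starSubalgebra_topologicalClosure_eq_top_of_separatesPoints _
      ratCharSubalgebra_separatesPoints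
    rw [← StarSubalgebra.topologicalClosure_coe, this]
    rfl
  refine h1.induction (P := fun φ => ψ φ = 0) (fun φ hφ => ?_)
    (isClosed_eq (by fun_prop) continuous_const) φ
  have h2 : φ ∈ Submodule.span ℂ (Set.range fun x : ℕ+ × ℕ+ => ratChar x.1 x.2) := by
    rw [← ratCharSubalgebra_toSubmodule]
    exact hφ
  refine (Submodule.span_le (p := LinearMap.ker (ψ : C(Polytorus, ℂ) →ₗ[ℂ] ℂ))).2 ?_ h2
  rintro _ ⟨⟨m, n⟩, rfl⟩
  exact hψ m n

/-! ### Integrable functions with vanishing Fourier coefficients -/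

theorem setIntegral_eq_zero_of_isPiSystem {α E : Type*} [m : MeasurableSpace α]
    [NormedAddCommGroup E] [NormedSpace ℝ E] [CompleteSpace E] {ρ : Measure α} {f : α → E}
    (hf : Integrable f ρ) {𝒮 : Set (Set α)} (hgen : m = MeasurableSpace.generateFrom 𝒮)
    (hpi : IsPiSystem 𝒮) (huniv : ∫ x, f x ∂ρ = 0) (h𝒮 : ∀ s ∈ 𝒮, ∫ x in s, f x ∂ρ = 0)
    {s : Set α} (hs : MeasurableSet s) : ∫ x in s, f x ∂ρ = 0 := by
  induction s, hs using MeasurableSpace.induction_on_inter hgen hpi with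
  | empty => simp
  | basic t ht => exact h𝒮 t ht
  | compl t ht ih => rw [setIntegral_compl ht hf, ih, huniv, sub_zero]
  | iUnion g hd hm ih =>
    rw [integral_iUnion hm hd hf.integrableOn]
    simp [ih]

/-- The functional `φ ↦ ∫ H(x, χ) φ(χ)`. -/
def slicePairing {α : Type*} [MeasurableSpace α] {ρ : Measure (α × Polytorus)}
    {H : α × Polytorus → ℂ} (hH : Integrable H ρ) : C(Polytorus, ℂ) →L[ℂ] ℂ :=
  have hi : ∀ φ : C(Polytorus, ℂ), Integrable (fun x => H x * φ x.2) ρ := fun φ =>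
    hH.mul_bdd (c := ‖φ‖) (φ.continuous.measurable.comp measurable_snd).aestronglyMeasurable
      (Eventually.of_forall fun x => φ.norm_coe_le_norm x.2)
  LinearMap.mkContinuous
    { toFun := fun φ => ∫ x, H x * φ x.2 ∂ρ
      map_add' := fun φ ψ => by
        simp_rw [ContinuousMap.add_apply, mul_add]
        exact integral_add (hi φ) (hi ψ)
      map_smul' := fun c φ => by
        simp_rw [ContinuousMap.smul_apply, smul_eq_mul, mul_left_comm, RingHom.id_apply]
        exact integral_const_mul _ _ } (∫ x, ‖H x‖ ∂ρ) fun φ => by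
    refine (norm_integral_le_integral_norm _).trans ?_
    rw [← integral_mul_const]
    refine integral_mono (hi φ).norm (hH.norm.mul_const _) fun x => ?_
    rw [norm_mul]
    exact mul_le_mul_of_nonneg_left (φ.norm_coe_le_norm x.2) (norm_nonneg _)

/-- Vanishing against characters gives vanishing against all continuous functions of `χ`; the
indicator of a closed set is a bounded pointwise limit of these. -/
theorem setIntegral_snd_eq_zero {α : Type*} [MeasurableSpace α] {ρ : Measure (α × Polytorus)}
    {H : α × Polytorus → ℂ} (hH : Integrable H ρ)
    (h : ∀ m n, ∫ x, H x * ratChar m n x.2 ∂ρ = 0) {C : Set Polytorus} (hC : IsClosed C) :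
    ∫ x in Prod.snd ⁻¹' C, H x ∂ρ = 0 := by
  have h0 : ∀ φ : C(Polytorus, ℂ), ∫ x, H x * φ x.2 ∂ρ = 0 :=
    fun φ => eq_zero_of_forall_ratChar (ψ := slicePairing hH) h φ
  set g : ℕ → C(Polytorus, ℂ) := fun k =>
    ⟨fun χ => ((hC.apprSeq k χ : ℝ) : ℂ), Complex.continuous_ofReal.comp
      (NNReal.continuous_coe.comp (hC.apprSeq k).continuous)⟩ with hg
  have hg1 : ∀ k χ, ‖g k χ‖ ≤ 1 := by
    intro k χ
    change ‖((hC.apprSeq k χ : ℝ) : ℂ)‖ ≤ 1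
    rw [Complex.norm_real, Real.norm_of_nonneg (NNReal.coe_nonneg _)]
    exact_mod_cast HasOuterApproxClosed.apprSeq_apply_le_one hC k χ
  have hlim : ∀ χ, Tendsto (fun k => g k χ) atTop (𝓝 (C.indicator (fun _ => (1 : ℂ)) χ)) := by
    intro χ
    have h1 := tendsto_pi_nhds.1 (HasOuterApproxClosed.tendsto_apprSeq hC) χ
    have h2 := (Complex.continuous_ofReal.tendsto _).comp
      ((NNReal.continuous_coe.tendsto _).comp h1)
    refine h2.congr' (EventuallyEq.refl _ _) |>.trans_eq ?_
    by_cases hχ : χ ∈ C <;> simp [hχ]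
  have h1 : Tendsto (fun k => ∫ x, H x * g k x.2 ∂ρ) atTop
      (𝓝 (∫ x, H x * C.indicator (fun _ => (1 : ℂ)) x.2 ∂ρ)) := by
    refine tendsto_integral_of_dominated_convergence (fun x => ‖H x‖) (fun k => ?_) hH.norm
      (fun k => Eventually.of_forall fun x => ?_) (Eventually.of_forall fun x => ?_)
    · exact hH.1.mul ((g k).continuous.measurable.comp measurable_snd).aestronglyMeasurable
    · rw [norm_mul]
      exact mul_le_of_le_one_right (norm_nonneg _) (hg1 k x.2)
    · exact (hlim x.2).const_mul (H x)
  simp_rw [h0] at h1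
  have h2 := tendsto_nhds_unique h1 tendsto_const_nhds
  rw [← integral_indicator (measurable_snd hC.measurableSet), ← h2]
  refine integral_congr_ae (Eventually.of_forall fun x => ?_)
  by_cases hx : x.2 ∈ C <;> simp [Set.indicator, hx]

/-- Products of a measurable set and a closed set form a π-system generating the product σ-algebra.
-/
theorem setIntegral_eq_zero_of_fourier_eq_zero {α : Type*} [MeasurableSpace α]
    {ρ : Measure (α × Polytorus)} {H : α × Polytorus → ℂ} (hH : Integrable H ρ)
    (h : ∀ B : Set α, MeasurableSet B → ∀ m n,
      ∫ x in Prod.fst ⁻¹' B, H x * ratChar m n x.2 ∂ρ = 0)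
    {s : Set (α × Polytorus)} (hs : MeasurableSet s) : ∫ x in s, H x ∂ρ = 0 := by
  have h1 : ∀ B : Set α, MeasurableSet B → ∀ C : Set Polytorus, IsClosed C →
      ∫ x in B ×ˢ C, H x ∂ρ = 0 := by
    intro B hB C hC
    have := setIntegral_snd_eq_zero (ρ := ρ.restrict (Prod.fst ⁻¹' B)) hH.integrableOn (h B hB) hC
    rwa [Measure.restrict_restrict (measurable_snd hC.measurableSet), Set.inter_comm] at this
  refine setIntegral_eq_zero_of_isPiSystem hH
    (𝒮 := Set.image2 (· ×ˢ ·) {B : Set α | MeasurableSet B} {C : Set Polytorus | IsClosed C})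
    ?_ ?_ ?_ ?_ hs
  · refine (generateFrom_eq_prod MeasurableSpace.generateFrom_measurableSet ?_
      isCountablySpanning_measurableSet
      ⟨fun _ => Set.univ, fun _ => isClosed_univ, Set.iUnion_const _⟩).symm
    exact (BorelSpace.measurable_eq.trans borel_eq_generateFrom_isClosed).symm
  · exact MeasurableSpace.isPiSystem_measurableSet.prod isPiSystem_isClosed
  · simpa using h1 Set.univ MeasurableSet.univ Set.univ isClosed_univ
  · rintro _ ⟨B, hB, C, hC, rfl⟩
    exact h1 B hB C hC

/-! ### The Bergman space as a space of functions of `(σ, χ)` -/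

section Injectivity

variable (p : ℝ) [Fact (1 ≤ p)] (μ : Measure ℝ)

instance instFactOneLeOfReal : Fact (1 ≤ ENNReal.ofReal p) :=
  ⟨by simpa using (Fact.out : 1 ≤ p)⟩

/-- The lift `P ↦ ((σ, χ) ↦ D(P_σ)(χ))` as a linear map to `L^p`. -/
def jointLin [IsFiniteMeasure μ] :
    DirichletPoly →ₗ[ℂ] Lp ℂ (ENNReal.ofReal p) (jointMeasure μ) where
  toFun P := (memLp_jointLift (ENNReal.ofReal p) μ P).toLp (jointLift P)
  map_add' P Q := by
    rw [← MemLp.toLp_add]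
    exact MemLp.toLp_congr _ _ (Eventually.of_forall fun x => by rw [jointLift_add])
  map_smul' c P := by
    rw [RingHom.id_apply, ← MemLp.toLp_const_smul]
    exact MemLp.toLp_congr _ _ (Eventually.of_forall fun x => by rw [jointLift_smul])

omit [Fact (1 ≤ p)] in
theorem jointLin_ae_eq [IsFiniteMeasure μ] (P : DirichletPoly) :
    jointLin p μ P =ᵐ[jointMeasure μ] jointLift P :=
  MemLp.coeFn_toLp (memLp_jointLift (ENNReal.ofReal p) μ P)

theorem norm_jointLin [IsFiniteMeasure μ] (P : DirichletPoly) :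
    ‖jointLin p μ P‖ = ‖ofPolyLin p μ P‖ := by
  rw [norm_ofPolyLin, bergmanNorm_eq p Fact.out]
  exact Lp.norm_toLp _ (memLp_jointLift (ENNReal.ofReal p) μ P)

/-- The isometric embedding of the Bergman space in `L^p`. -/
def jointBergman [IsFiniteMeasure μ] :
    BergmanSpace p μ →L[ℂ] Lp ℂ (ENNReal.ofReal p) (jointMeasure μ) :=
  (jointLin p μ).extendOfNorm (ofPolyLin p μ)

theorem jointBergman_ofPolyLin [IsFiniteMeasure μ] (P : DirichletPoly) :
    jointBergman p μ (ofPolyLin p μ P) = jointLin p μ P :=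
  LinearMap.extendOfNorm_eq (denseRange_ofPolyLin p μ)
    ⟨1, fun Q => by rw [one_mul, norm_jointLin]⟩ P

theorem norm_jointBergman [IsFiniteMeasure μ] (f : BergmanSpace p μ) :
    ‖jointBergman p μ f‖ = ‖f‖ := by
  refine (denseRange_ofPolyLin p μ).induction_on (p := fun f => ‖jointBergman p μ f‖ = ‖f‖) f
    (isClosed_eq (by fun_prop) (by fun_prop)) fun P => ?_
  rw [jointBergman_ofPolyLin, norm_jointLin]

theorem integrable_Lp [IsFiniteMeasure μ] (H : Lp ℂ (ENNReal.ofReal p) (jointMeasure μ)) :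
    Integrable H (jointMeasure μ) :=
  (Lp.memLp H).integrable Fact.out

variable [IsProbabilityMeasure μ] (hμ : μ (Set.Iio 0) = 0)

/-- The functional `H ↦ ∫_{σ ∈ B} H(σ, χ) χ(m) conj χ(n)`. -/
def fourierPairing (B : Set ℝ) (m n : ℕ+) :
    Lp ℂ (ENNReal.ofReal p) (jointMeasure μ) →L[ℂ] ℂ :=
  have hi : ∀ H : Lp ℂ (ENNReal.ofReal p) (jointMeasure μ),
      Integrable (fun x => H x * ratChar m n x.2) (jointMeasure μ) := fun H =>
    (integrable_Lp p μ H).mul_bdd (c := 1)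
      ((ratChar m n).continuous.measurable.comp measurable_snd).aestronglyMeasurable
      (Eventually.of_forall fun x => (norm_ratChar_apply m n x.2).le)
  LinearMap.mkContinuous
    { toFun := fun H => ∫ x in Prod.fst ⁻¹' B, H x * ratChar m n x.2 ∂(jointMeasure μ)
      map_add' := fun H₁ H₂ => by
        rw [← integral_add (hi H₁).integrableOn (hi H₂).integrableOn]
        refine integral_congr_ae (ae_restrict_of_ae ?_)
        filter_upwards [Lp.coeFn_add H₁ H₂] with x hx
        rw [hx, Pi.add_apply, add_mul]
      map_smul' := fun c H => by
        rw [RingHom.id_apply, smul_eq_mul, ← integral_const_mul]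
        refine integral_congr_ae (ae_restrict_of_ae ?_)
        filter_upwards [Lp.coeFn_smul c H] with x hx
        rw [hx, Pi.smul_apply, smul_eq_mul, mul_assoc] }
    -- Hölder's constant for comparing the `L^1` and `L^p` norms on a finite measure space.
    ((jointMeasure μ).real Set.univ ^ (1 - 1 / p)) fun H => by
    have hp : 1 ≤ p := Fact.out
    refine (norm_integral_le_integral_norm _).trans ?_
    refine (setIntegral_le_integral (hi H).norm
      (Eventually.of_forall fun _ => norm_nonneg _)).trans ?_
    simp_rw [norm_mul, norm_ratChar_apply, mul_one]
    have hm := (Lp.memLp H).1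
    rw [integral_norm_eq_lintegral_enorm hm, ← eLpNorm_one_eq_lintegral_enorm, Lp.norm_def,
      Measure.real, ENNReal.toReal_rpow, ← ENNReal.toReal_mul, mul_comm]
    refine ENNReal.toReal_mono (ENNReal.mul_ne_top (Lp.eLpNorm_ne_top H) ?_) ?_
    · exact ENNReal.rpow_ne_top_of_nonneg
        (by rw [sub_nonneg, div_le_one (by linarith)]; exact hp) (measure_ne_top _ _)
    · have := eLpNorm_le_eLpNorm_mul_rpow_measure_univ (p := 1) (q := ENNReal.ofReal p)
        (by simpa using hp) hm
      rwa [ENNReal.toReal_ofReal (by linarith), ENNReal.toReal_one, div_one] at this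

theorem fourierPairing_apply (B : Set ℝ) (m n : ℕ+)
    (H : Lp ℂ (ENNReal.ofReal p) (jointMeasure μ)) :
    fourierPairing p μ B m n H =
      ∫ x in Prod.fst ⁻¹' B, H x * ratChar m n x.2 ∂(jointMeasure μ) := rfl

theorem fourierPairing_single_eq_zero (B : Set ℝ) {l m n : ℕ+} (h : l * m ≠ n) (a : ℂ) :
    fourierPairing p μ B m n (jointLin p μ (Finsupp.single l a)) = 0 := by
  rw [fourierPairing_apply]
  have h1 : ∫ x in Prod.fst ⁻¹' B, jointLin p μ (Finsupp.single l a) x * ratChar m n x.2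
      ∂(jointMeasure μ) = ∫ x in B ×ˢ Set.univ, (a * (l : ℂ) ^ (-(x.1 : ℂ))) *
        ratChar (l * m) n x.2 ∂(jointMeasure μ) := by
    rw [Set.prod_univ]
    refine integral_congr_ae (ae_restrict_of_ae ?_)
    filter_upwards [jointLin_ae_eq p μ (Finsupp.single l a)] with x hx
    rw [hx, jointLift, Finsupp.sum_single_index (by simp), ratChar_apply, ratChar_apply,
      charValue_mul, Circle.coe_mul]
    ring
  rw [h1, jointMeasure, setIntegral_prod_mul (fun σ : ℝ => a * (l : ℂ) ^ (-(σ : ℂ)))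
    (fun χ => ratChar (l * m) n χ), Measure.restrict_univ, integral_ratChar h, mul_zero]

/-- By orthogonality only the monomial `l` with `l * m = n` is seen, and there is at most one. Both
sides of the identity are continuous, so it carries over to the whole Bergman space. -/
theorem exists_fourierPairing_eq_coeff (B : Set ℝ) (m n : ℕ+) :
    ∃ (l : ℕ+) (c : ℂ), ∀ P, fourierPairing p μ B m n (jointLin p μ P) = c * P l := by
  obtain ⟨l, hl⟩ : ∃ l : ℕ+, ∀ k, k ≠ l → k * m ≠ n := by
    by_cases h : ∃ l : ℕ+, l * m = n
    · obtain ⟨l, hl⟩ := h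
      exact ⟨l, fun k hk h => hk (mul_right_cancel (h.trans hl.symm))⟩
    -- If `m` does not divide `n`, the pairing vanishes on every polynomial and any index serves.
    · exact ⟨1, fun k _ hk => h ⟨k, hk⟩⟩
  refine ⟨l, fourierPairing p μ B m n (jointLin p μ (Finsupp.single l 1)), fun P => ?_⟩
  induction P using Finsupp.induction_linear with
  | zero => simp
  | add P Q hP hQ => rw [map_add, map_add, hP, hQ, Finsupp.add_apply, mul_add]
  | single k a =>
    rcases eq_or_ne k l with rfl | hk
    · have : (Finsupp.single k a : DirichletPoly) = a • Finsupp.single k 1 := by simp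
      rw [this, map_smul, map_smul, Finsupp.smul_apply, Finsupp.single_eq_same, smul_eq_mul,
        smul_eq_mul, mul_one, mul_comm]
    · rw [fourierPairing_single_eq_zero p μ B (hl k hk), Finsupp.single_eq_of_ne hk.symm, mul_zero]

include hμ in
theorem eq_zero_of_coeffBergman_eq_zero (h0 : (0 : ℝ) ∈ μ.support) {f : BergmanSpace p μ}
    (hf : ∀ n, coeffBergman p μ n f = 0) : f = 0 := by
  have h1 : ∀ (B : Set ℝ) (m n : ℕ+),
      fourierPairing p μ B m n (jointBergman p μ f) = 0 := by
    intro B m n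
    obtain ⟨l, c, hc⟩ := exists_fourierPairing_eq_coeff p μ B m n
    have h2 : ∀ g, fourierPairing p μ B m n (jointBergman p μ g) = c * coeffBergman p μ l g := by
      intro g
      refine (denseRange_ofPolyLin p μ).induction_on (p := fun g =>
        fourierPairing p μ B m n (jointBergman p μ g) = c * coeffBergman p μ l g) g
        (isClosed_eq (by fun_prop) (by fun_prop)) fun P => ?_
      rw [jointBergman_ofPolyLin, hc, coeffBergman_ofPolyLin p μ hμ h0]
    rw [h2, hf, mul_zero]
  have hp : 1 ≤ p := Fact.out
  have h2 : jointBergman p μ f =ᵐ[jointMeasure μ] 0 := by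
    refine Lp.ae_eq_zero_of_forall_setIntegral_eq_zero _ (by simp; linarith)
      ENNReal.ofReal_ne_top (fun s _ _ => (integrable_Lp p μ _).integrableOn) fun s hs _ => ?_
    exact setIntegral_eq_zero_of_fourier_eq_zero (integrable_Lp p μ _) (fun B _ m n => h1 B m n) hs
  have h3 : jointBergman p μ f = 0 := (Lp.eq_zero_iff_ae_eq_zero).2 h2
  rw [← norm_eq_zero, ← norm_jointBergman, h3, norm_zero]

end Injectivity

end DirichletBergman

end

theorem mainTheorem8 (p : ℝ) [Fact (1 ≤ p)] (μ : Measure ℝ) [IsProbabilityMeasure μ]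
    (hμ : μ (Set.Iio 0) = 0) (h0 : (0 : ℝ) ∈ μ.support) :
    ∃ δ : ℂ → (DirichletBergman.BergmanSpace p μ →L[ℂ] ℂ),
      (∀ s : ℂ, 1 / 2 < s.re → ∀ P : DirichletBergman.DirichletPoly,
        δ s (DirichletBergman.BergmanSpace.ofPoly p μ P) = P.eval s) ∧
      (∀ f : DirichletBergman.BergmanSpace p μ, ∃ a : ℕ → ℂ,
        DirichletBergman.abscissaOfUniformConv a ≤ ((1 / 2 : ℝ) : EReal) ∧
        ∀ s : ℂ, 1 / 2 < s.re →
          Tendsto (fun N : ℕ => DirichletBergman.partialSum a N s) atTop (𝓝 (δ s f))) ∧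
      (∀ f g : DirichletBergman.BergmanSpace p μ,
        (∀ s : ℂ, 1 / 2 < s.re → δ s f = δ s g) → f = g) := by
  refine ⟨DirichletBergman.evalBergman p μ, fun s hs P => ?_, fun f => ?_, fun f g h => ?_⟩
  · exact DirichletBergman.evalBergman_ofPolyLin p μ hμ h0 hs P
  · exact ⟨DirichletBergman.coeffSeq p μ f,
      DirichletBergman.abscissaOfUniformConv_coeffSeq_le p μ hμ h0 f,
      fun s hs => DirichletBergman.tendsto_partialSum_coeffSeq p μ hμ h0 hs f⟩
  · refine sub_eq_zero.1 (DirichletBergman.eq_zero_of_coeffBergman_eq_zero p μ hμ h0 ?_)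
    refine DirichletBergman.coeffBergman_eq_zero_of_evalBergman_eq_zero p μ hμ h0 fun s hs => ?_
    rw [map_sub, h s hs, sub_self]
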